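/- Let $(\Omega,\mathcal F,P)$ be a probability space that is nonatomic, i.e. supports a random variable with a continuous distribution, and let $\rho:L^\infty(P)\to\mathbb R$. Definitions. ("Increasing" and "decreasing" are meant in the weak sense.) $\rho$ is a *monetary risk measure* if $X\le Y$ a.s. implies $\rho(X)\ge\rho(Y)$, and $\rho(X+m)=\rho(X)-m$ for $m\in\mathbb R$. It is *positively homogeneous* if $\rho(aX)=a\rho(X)$ for all $a\ge 0$. It is *SSD-consistent* if $\rho(X)\le\rho(Y)$ whenever $E_P[f(X)]\ge E_P[f(Y)]$ for all increasing concave $f:\mathbb R\to\mathbb R$. With $F_X$ the distribution function of $X$, put $q_X(t)=\inf\{x\in\mathbb R: F_X(x)>t\}$ for $t\in[0,1)$, $q_X(1)=\lim_{t\uparrow1}q_X(t)$, and $\mathrm{VaR}_t(X)=-q_X(t)$ for $t\in[0,1]$. Let $\mathcal G^{\downarrow}$ be the set of decreasing functions $g:(0,1)\to[0,\infty)$ with $\int_0^1 g(t)\,dt=1$. Let $\mathcal W$ be the set of probability distribution functions on $[0,1]$, i.e. increasing right-continuous $w:[0,1]\to[0,1]$ with $w(1)=1$, where $w(0)$ is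 the mass of $\{0\}$; it carries the weak topology induced by the continuous functions on $[0,1]$. Let $\Psi$ be the set of $\psi\in\mathcal W$ that are concave on $[0,1]$, with the topology carried over from $\mathcal W$ by the bijection $J:\mathcal W\to\Psi$, $w\mapsto\psi$, determined by $\psi(0)=w(0)$ and $\psi'(t)=\int_{(t,1]}s^{-1}\,dw(s)$ (right derivative, $0<t<1$). A functional with values in $(-\infty,\infty]$ on one of the convex sets $\mathcal G^{\downarrow}$, $\Psi$ is called convex with respect to pointwise convex combinations. (a) Each of the following two conditions (i) and (ii) is equivalent to $\rho$ being an SSD-consistent monetary risk measure. (i) There is a family $(\alpha_\lambda)_{\lambda\in\Lambda}$ of convex functionals $\alpha_\lambda:\mathcal G^{\downarrow}\to(-\infty,\infty]$ such that $$\rho(X)=\min_{\lambda\in\Lambda}\ \sup_{g\in\mathcal G^{\downarrow}}\Big(\int_0^1\mathrm{VaR}_t(X)g(t)\,dt-\alpha_\lambda(g)\Big)\quad\text{for all }X\in L^\infty(P).$$ (ii) There is a family $(\alpha_\lambda)_{\lambda\in\Lambda}$ of lower semicontinuous convex functionals $\alpha_\lambda:\Psi\to(-\infty,\infty]$ such that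 $$\rho(X)=\min_{\lambda\in\Lambda}\ \max_{\psi\in\Psi}\Big(\int_{[0,1]}\mathrm{VaR}_t(X)\,d\psi(t)-\alpha_\lambda(\psi)\Big)\quad\text{for all }X\in L^\infty(P).$$ (b) $\rho$ is an SSD-consistent, positively homogeneous monetary risk measure if and only if there is a family $(\Psi_\lambda)_{\lambda\in\Lambda}$ of nonempty, compact, convex subsets of $\Psi$ such that $$\rho(X)=\min_{\lambda\in\Lambda}\ \max_{\psi\in\Psi_\lambda}\int_{[0,1]}\mathrm{VaR}_t(X)\,d\psi(t)\quad\text{for all }X\in L^\infty(P).$$ The minima over $\lambda$ and the maxima over $\psi$ are attained, for every $X$ (and every $\lambda$); the inner suprema and maxima in (a) are taken in $[-\infty,\infty]$. -/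

import Mathlib

open MeasureTheory Set unitInterval

noncomputable section

namespace RiskMeasures

/-! ### Risk measures on the space of essentially bounded random variables -/

section Risk

variable {Ω : Type*} [MeasurableSpace Ω]

/-- The space of (almost sure equivalence classes of) essentially bounded real random variables. -/
abbrev Linfty (P : Measure Ω) := Lp ℝ ⊤ P

/-- The probability space supports a random variable with a continuous distribution. -/
def IsNonatomic (P : Measure Ω) : Prop :=
  ∃ U : Ω → ℝ, Measurable U ∧ ∀ x : ℝ, P (U ⁻¹' {x}) = 0

/-- Monetary risk measures; `≤` on `Linfty P` is the almost sure order. -/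
structure IsMonetary (P : Measure Ω) [IsProbabilityMeasure P] (ρ : Linfty P → ℝ) : Prop where
  monotonicity : ∀ X Y : Linfty P, X ≤ Y → ρ Y ≤ ρ X
  translation : ∀ (X : Linfty P) (m : ℝ), ρ (X + Lp.const ⊤ P m) = ρ X - m

/-- Positive homogeneity. -/
def IsPosHomogeneous (P : Measure Ω) (ρ : Linfty P → ℝ) : Prop :=
  ∀ (X : Linfty P) (a : ℝ), 0 ≤ a → ρ (a • X) = a * ρ X

/-- Second-order stochastic dominance of `X` over `Y`. -/
def SSD (P : Measure Ω) (X Y : Linfty P) : Prop :=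
  ∀ f : ℝ → ℝ, Monotone f → ConcaveOn ℝ univ f → ∫ ω, f (Y ω) ∂P ≤ ∫ ω, f (X ω) ∂P

/-- Consistency with second-order stochastic dominance. -/
def IsSSDConsistent (P : Measure Ω) (ρ : Linfty P → ℝ) : Prop :=
  ∀ X Y : Linfty P, SSD P X Y → ρ X ≤ ρ Y

/-- The upper quantile function `inf {x | F_X x > t}` of `X`, for `t ∈ [0, 1)`. -/
def upperQuantile (P : Measure Ω) (X : Linfty P) (t : ℝ) : ℝ :=
  sInf {x : ℝ | t < ProbabilityTheory.cdf (P.map X) x}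

/-- The quantile function on `[0, 1]`; its value at `1` is the left limit there. -/
def quantile (P : Measure Ω) (X : Linfty P) (t : ℝ) : ℝ :=
  if t < 1 then upperQuantile P X t else Function.leftLim (upperQuantile P X) 1

/-- Value at risk at level `t ∈ [0, 1]`. -/
def VaR (P : Measure Ω) (X : Linfty P) (t : ℝ) : ℝ := -quantile P X t

end Risk

/-! ### Densities on `(0, 1)` and distribution functions on `[0, 1]` -/

/-- Lebesgue measure on `(0, 1)`. -/
def lebesgue : Measure (Ioo (0 : ℝ) 1) := Measure.comap Subtype.val volume

/-- Decreasing probability densities on `(0, 1)`. -/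
def decreasingDensities : Set (Ioo (0 : ℝ) 1 → ℝ) :=
  {g | Measurable g ∧ (∀ t, 0 ≤ g t) ∧ ∫ t, g t ∂lebesgue = 1 ∧ Antitone g}

/-- Probability distribution functions on `[0, 1]`: increasing right-continuous functions `w`
with `0 ≤ w 0` and `w 1 = 1`. -/
structure DistFun extends StieltjesFunction I where
  zero_nonneg : 0 ≤ toFun 0
  map_one : toFun 1 = 1

namespace DistFun

/-- The probability measure on `[0, 1]` with distribution function `w`. The Stieltjes measure has
mass `w b - w a` on `(a, b]` and none on `{0}`, where the mass has to be `w 0`. -/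
def measure (w : DistFun) : Measure I :=
  w.toStieltjesFunction.measure + ENNReal.ofReal (w.toFun 0) • Measure.dirac 0

lemma measure_Ioc (w : DistFun) (a b : I) :
    w.measure (Ioc a b) = ENNReal.ofReal (w.toFun b - w.toFun a) := by
  have : (0 : I) ∉ Ioc a b := fun h => absurd h.1 (not_lt.2 a.2.1)
  simp [measure, this]

lemma measure_Iic (w : DistFun) (t : I) :
    w.measure (Iic t) = ENNReal.ofReal (w.toFun t) := by
  have h0 : w.toStieltjesFunction.measure ({0} : Set I) = 0 := by
    have := w.toStieltjesFunction.measure_botSet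
    rwa [botSet_eq_singleton_of_isBot (x := (0 : I)) (fun a => a.2.1)] at this
  have h1 : (Iic t : Set I) = {0} ∪ Ioc 0 t := by
    ext x
    simp only [mem_Iic, mem_union, mem_singleton_iff, mem_Ioc]
    constructor
    · intro h
      rcases eq_or_lt_of_le (show (0 : I) ≤ x from x.2.1) with h' | h'
      · exact Or.inl h'.symm
      · exact Or.inr ⟨h', h⟩
    · rintro (h | h)
      · rw [h]; exact t.2.1
      · exact h.2
  have hd : Disjoint ({0} : Set I) (Ioc 0 t) := by simp
  have hm : w.toFun 0 ≤ w.toFun t := w.mono' t.2.1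
  rw [h1, measure_union hd measurableSet_Ioc, measure_Ioc]
  have : w.measure ({0} : Set I) = ENNReal.ofReal (w.toFun 0) := by
    simp [measure, h0]
  rw [this, ← ENNReal.ofReal_add w.zero_nonneg (sub_nonneg.2 hm)]
  congr 1
  ring

instance (w : DistFun) : IsProbabilityMeasure w.measure := by
  constructor
  have h : (univ : Set I) = Iic 1 := by
    ext x
    exact ⟨fun _ => x.2.2, fun _ => mem_univ x⟩
  rw [h, measure_Iic, w.map_one, ENNReal.ofReal_one]

/-- The weak topology: `w ↦ ∫ f dw` is continuous for every continuous `f` on `[0, 1]`. -/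
instance : TopologicalSpace DistFun :=
  TopologicalSpace.induced (fun w => (⟨w.measure, inferInstance⟩ : ProbabilityMeasure I))
    (inferInstance : TopologicalSpace (ProbabilityMeasure I))

end DistFun

/-- Concave probability distribution functions on `[0, 1]`. -/
structure ConcaveDistFun extends DistFun where
  concave : ConcaveOn ℝ (Icc 0 1) (IccExtend zero_le_one toFun)

/-- The function `w 0 + ∫_{(0, 1]} min (t / s) 1 dw(s)` of `t ∈ [0, 1]`. -/
def mixFun (w : DistFun) (t : I) : ℝ :=
  w.toFun 0 + ∫ s in Ioc (0 : I) 1, min ((t : ℝ) / s) 1 ∂w.measure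

lemma mixFun_bound (t s : I) : ‖min ((t : ℝ) / s) 1‖ ≤ 1 := by
  rw [Real.norm_eq_abs, abs_of_nonneg (le_min (div_nonneg t.2.1 s.2.1) zero_le_one)]
  exact min_le_right _ _

lemma mixFun_measurable (t : ℝ) : Measurable fun s : I => min (t / (s : ℝ)) 1 := by
  fun_prop

lemma mixFun_integrable (w : DistFun) (t : I) (S : Set I) :
    Integrable (fun s : I => min ((t : ℝ) / s) 1) (w.measure.restrict S) :=
  Integrable.of_bound (mixFun_measurable t).aestronglyMeasurable 1
    (Filter.Eventually.of_forall fun s => mixFun_bound t s)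

lemma mixFun_zero (w : DistFun) : mixFun w 0 = w.toFun 0 := by
  simp [mixFun]

lemma mixFun_one (w : DistFun) : mixFun w 1 = 1 := by
  have h : ∫ s in Ioc (0 : I) 1, min (((1 : I) : ℝ) / s) 1 ∂w.measure
      = ∫ s in Ioc (0 : I) 1, (1 : ℝ) ∂w.measure := by
    refine setIntegral_congr_fun measurableSet_Ioc fun s hs => ?_
    have hs0 : (0 : ℝ) < s := hs.1
    have hs1 : (s : ℝ) ≤ 1 := s.2.2
    simp only [Icc.coe_one]
    exact min_eq_right ((one_le_div hs0).2 hs1)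
  have hm : w.toFun 0 ≤ w.toFun 1 := w.mono' zero_le_one
  rw [mixFun, h, setIntegral_const, Measure.real, DistFun.measure_Ioc,
    ENNReal.toReal_ofReal (sub_nonneg.2 hm), w.map_one]
  simp

lemma mixFun_mono (w : DistFun) : Monotone (mixFun w) := by
  intro t t' h
  refine add_le_add le_rfl (integral_mono (mixFun_integrable w t _) (mixFun_integrable w t' _) ?_)
  intro s
  exact min_le_min (div_le_div_of_nonneg_right h s.2.1) le_rfl

lemma mixFun_continuous (w : DistFun) : Continuous (mixFun w) := by
  refine continuous_const.add (continuous_of_dominated (bound := fun _ => 1) ?_ ?_ ?_ ?_)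
  · intro t
    exact (mixFun_measurable t).aestronglyMeasurable
  · intro t
    exact Filter.Eventually.of_forall fun s => mixFun_bound t s
  · exact integrable_const _
  · exact Filter.Eventually.of_forall fun s => by fun_prop

lemma mixFun_concave (w : DistFun) :
    ConcaveOn ℝ (Icc 0 1) (IccExtend (zero_le_one (α := ℝ)) (mixFun w)) := by
  refine ⟨convex_Icc 0 1, fun x hx y hy a b ha hb hab => ?_⟩
  have hz : a • x + b • y ∈ Icc (0 : ℝ) 1 := convex_Icc 0 1 hx hy ha hb hab
  rw [IccExtend_of_mem _ _ hx, IccExtend_of_mem _ _ hy, IccExtend_of_mem _ _ hz]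
  simp only [mixFun, smul_eq_mul]
  have h : a * (∫ s in Ioc (0 : I) 1, min (x / s) 1 ∂w.measure)
      + b * (∫ s in Ioc (0 : I) 1, min (y / s) 1 ∂w.measure)
      ≤ ∫ s in Ioc (0 : I) 1, min ((a * x + b * y) / s) 1 ∂w.measure := by
    have ix := mixFun_integrable w ⟨x, hx⟩ (Ioc 0 1)
    have iy := mixFun_integrable w ⟨y, hy⟩ (Ioc 0 1)
    rw [← integral_const_mul, ← integral_const_mul,
      ← integral_add (ix.const_mul a) (iy.const_mul b)]
    refine integral_mono ((ix.const_mul a).add (iy.const_mul b))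
      (mixFun_integrable w ⟨_, hz⟩ (Ioc 0 1)) fun s => ?_
    refine le_min ?_ ?_
    · rw [add_div, mul_div_assoc, mul_div_assoc]
      exact add_le_add (mul_le_mul_of_nonneg_left (min_le_left _ _) ha)
        (mul_le_mul_of_nonneg_left (min_le_left _ _) hb)
    · calc a * min (x / s) 1 + b * min (y / s) 1 ≤ a * 1 + b * 1 :=
            add_le_add (mul_le_mul_of_nonneg_left (min_le_right _ _) ha)
              (mul_le_mul_of_nonneg_left (min_le_right _ _) hb)
        _ = 1 := by rw [mul_one, mul_one, hab]
  have hc : a * w.toFun 0 + b * w.toFun 0 = w.toFun 0 := by rw [← add_mul, hab, one_mul]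
  nlinarith [h, hc]

/-- The map `w ↦ ψ` from distribution functions to concave distribution functions that is
determined by `ψ 0 = w 0` and `ψ' t = ∫_{(t, 1]} s⁻¹ dw(s)` (right derivative), in integrated
form; these two identities are `J_zero` and `J_hasDerivWithinAt`. -/
def J (w : DistFun) : ConcaveDistFun where
  toFun := mixFun w
  mono' := mixFun_mono w
  right_continuous' := fun _ => (mixFun_continuous w).continuousWithinAt
  zero_nonneg := by rw [mixFun_zero]; exact w.zero_nonneg
  map_one := mixFun_one w
  concave := mixFun_concave w

lemma J_zero (w : DistFun) : (J w).toFun 0 = w.toFun 0 := mixFun_zero w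

lemma J_hasDerivWithinAt (w : DistFun) (t : I) (h0 : 0 < t) (h1 : t < 1) :
    HasDerivWithinAt (IccExtend (zero_le_one (α := ℝ)) (J w).toFun)
      (∫ s in Ioc t 1, (s : ℝ)⁻¹ ∂w.measure) (Ici (t : ℝ)) t := by
  have ht0 : (0 : ℝ) < t := h0
  have ht1 : (t : ℝ) < 1 := h1
  rw [← hasDerivWithinAt_Ioi_iff_Ici, hasDerivWithinAt_iff_tendsto_slope' (by simp)]
  have hlim : ∫ s in Ioc t 1, (s : ℝ)⁻¹ ∂w.measure
      = ∫ s in Ioc (0 : I) 1, (Ioc t 1).indicator (fun s : I => (s : ℝ)⁻¹) s ∂w.measure := by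
    rw [setIntegral_indicator measurableSet_Ioc,
      inter_eq_self_of_subset_right (Ioc_subset_Ioc_left h0.le)]
  have hev : ∀ᶠ y in nhdsWithin (t : ℝ) (Ioi (t : ℝ)), y ∈ Ioo (t : ℝ) 1 := Ioo_mem_nhdsGT ht1
  have hslope : ∀ y ∈ Ioo (t : ℝ) 1,
      ∫ s in Ioc (0 : I) 1, (min (y / (s : ℝ)) 1 - min ((t : ℝ) / s) 1) / (y - t) ∂w.measure
        = slope (IccExtend (zero_le_one (α := ℝ)) (J w).toFun) t y := by
    intro y hy
    have hyI : y ∈ Icc (0 : ℝ) 1 := ⟨(ht0.trans hy.1).le, hy.2.le⟩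
    rw [slope_def_field, IccExtend_of_mem _ _ hyI, IccExtend_of_mem _ _ t.2, integral_div,
      integral_sub (mixFun_integrable w ⟨y, hyI⟩ _) (mixFun_integrable w t _)]
    simp only [J, mixFun]
    congr 1
    ring
  rw [hlim]
  refine Filter.Tendsto.congr' (hev.mono hslope)
    (tendsto_integral_filter_of_dominated_convergence (fun _ => (t : ℝ)⁻¹) ?_ ?_ ?_ ?_)
  · exact Filter.Eventually.of_forall fun y =>
      (((mixFun_measurable y).sub (mixFun_measurable t)).div_const _).aestronglyMeasurable
  · refine hev.mono fun y hy => ?_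
    filter_upwards [ae_restrict_mem measurableSet_Ioc] with s hs
    have hs0 : (0 : ℝ) < s := hs.1
    have hyt : 0 < y - t := sub_pos.2 hy.1
    have hmono : min ((t : ℝ) / s) 1 ≤ min (y / (s : ℝ)) 1 :=
      min_le_min (div_le_div_of_nonneg_right hy.1.le hs0.le) le_rfl
    rw [Real.norm_eq_abs, abs_of_nonneg (div_nonneg (sub_nonneg.2 hmono) hyt.le),
      div_le_iff₀ hyt]
    rcases le_or_gt (s : ℝ) t with h | h
    · rw [min_eq_right ((one_le_div hs0).2 h), min_eq_right ((one_le_div hs0).2 (h.trans hy.1.le)),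
        sub_self]
      positivity
    · rw [min_eq_left ((div_le_one hs0).2 h.le)]
      calc min (y / (s : ℝ)) 1 - t / s ≤ y / s - t / s := sub_le_sub_right (min_le_left _ _) _
        _ = (s : ℝ)⁻¹ * (y - t) := by ring
        _ ≤ (t : ℝ)⁻¹ * (y - t) :=
          mul_le_mul_of_nonneg_right (inv_anti₀ ht0 h.le) hyt.le
  · exact integrable_const _
  · filter_upwards [ae_restrict_mem measurableSet_Ioc] with s hs
    have hs0 : (0 : ℝ) < s := hs.1
    refine tendsto_const_nhds.congr' ?_
    rcases le_or_gt s t with h | h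
    · have h' : (s : ℝ) ≤ t := h
      refine hev.mono fun y hy => ?_
      beta_reduce
      rw [indicator_of_notMem (fun hm => absurd hm.1 (not_lt.2 h)),
        min_eq_right ((one_le_div hs0).2 h'), min_eq_right ((one_le_div hs0).2 (h'.trans hy.1.le)),
        sub_self, zero_div]
    · have h' : (t : ℝ) < s := h
      have hev' : ∀ᶠ y in nhdsWithin (t : ℝ) (Ioi (t : ℝ)), y ∈ Ioo (t : ℝ) s := Ioo_mem_nhdsGT h'
      refine hev'.mono fun y hy => ?_
      have hyt : y - t ≠ 0 := (sub_pos.2 hy.1).ne'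
      beta_reduce
      rw [indicator_of_mem (show s ∈ Ioc t 1 from ⟨h, hs.2⟩),
        min_eq_left ((div_le_one hs0).2 h'.le), min_eq_left ((div_le_one hs0).2 hy.2.le)]
      field_simp

/-- The topology carried over from the weak topology on distribution functions by the
bijection `J`. -/
instance : TopologicalSpace ConcaveDistFun := 
  TopologicalSpace.coinduced J (inferInstance : TopologicalSpace DistFun)

/-! ### Convex functionals and min-sup, min-max representations -/

/-- A functional `α : S → (-∞, ∞]` that is convex, where `e` embeds the convex set `S` in a real
vector space. -/
def IsConvexFunctional {S V : Type*} [AddCommMonoid V] [Module ℝ V] (e : S → V)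
    (α : S → EReal) : Prop :=
  (∀ x, α x ≠ ⊥) ∧
  ∀ (x y z : S) (a b : ℝ), 0 ≤ a → 0 ≤ b → a + b = 1 → e z = a • e x + b • e y →
    α z ≤ (a : EReal) * α x + (b : EReal) * α y

/-- `r = min_l sup_s F l s`, with the minimum attained. -/
def IsMinSup {Λ S : Type*} (F : Λ → S → EReal) (r : ℝ) : Prop :=
  IsLeast (range fun l => ⨆ s, F l s) (r : EReal)

/-- `r = min_l max_{s ∈ K l} F l s`, with the minimum and every maximum attained. -/
def IsMinMax {Λ S : Type*} (K : Λ → Set S) (F : Λ → S → EReal) (r : ℝ) : Prop :=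
  ∃ v : Λ → EReal, (∀ l, IsGreatest (F l '' K l) (v l)) ∧ IsLeast (range v) (r : EReal)

end RiskMeasures

end

open RiskMeasures

universe u v

noncomputable section

namespace RiskMeasures

/-! ### Quantile functions -/

section Quantile

variable {Ω : Type*} [MeasurableSpace Ω] {P : Measure Ω}

/-! Write q_X for the upper quantile and AVaR_s(X) for the mean of VaR(X) over levels in [0, s]. X
dominates Y in second order exactly when ∫_0^s q_Y ≤ ∫_0^s q_X for all s in (0, 1], that is, when
AVaR_s(X) ≤ AVaR_s(Y) for all such s (`SSD.integratedQuantileLE`, `IntegratedQuantileLE.ssd`,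
`integratedQuantileLE_iff`).

From representation to risk measure: every functional inside the sup or max is spectral, a VaR
average with some mass at level 0 and a decreasing density elsewhere (`isSpectral_density`,
`ConcaveDistFun.isSpectral`). By the layer-cake formula such a functional respects dominance; it is
also translation invariant and positively homogeneous, and these properties survive the min-sup.

From risk measure to representation in (a): take one penalty α_Z = (spectral value of Z) for each
acceptable position Z, i.e. ρ(Z) ≤ 0. If the sup of the differences between X and Z is at most r,
then AVaR(X) ≤ AVaR(Z) + r at every level, so X + r dominates Z and ρ(X) ≤ r (`le_of_AVaR_le`).
Equality occurs at Z = X + ρ(X), where all differences are ρ(X). Over Ψ the sup is a maximum because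
s ↦ AVaR_s is continuous on [0, 1], and a maximal difference at s is reached at J(δ_s).

For (b) the sets are Ψ_Z = {J w : ∫ AVaR_s(Z) dw(s) ≤ 0}. If X stays strictly below r on Ψ_Z, a
separation argument in the plane gives a ≥ 0 with AVaR(X) - r ≤ a AVaR(Z); hence X + r dominates aZ,
which is acceptable by homogeneity. Throughout, `integral_VaR_J` turns integrals against J w into
w-mixtures of AVaR. -/

lemma exists_ae_bound (X : Linfty P) : ∃ M : ℝ, 0 ≤ M ∧ ∀ᵐ ω ∂P, |X ω| ≤ M := by
  refine ⟨(eLpNorm X ⊤ P).toReal, ENNReal.toReal_nonneg, ?_⟩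
  have hfin : eLpNorm X ⊤ P ≠ ⊤ := Lp.eLpNorm_ne_top X
  filter_upwards [enorm_ae_le_eLpNormEssSup X P] with ω hω
  rw [← eLpNorm_exponent_top] at hω
  have := ENNReal.toReal_mono hfin hω
  simpa using this

lemma measurable_coe (X : Linfty P) : Measurable X := (Lp.stronglyMeasurable X).measurable

lemma VaR_of_lt_one (X : Linfty P) {t : ℝ} (ht : t < 1) : VaR P X t = -upperQuantile P X t := by
  rw [VaR, quantile, if_pos ht]

variable [IsProbabilityMeasure P]

instance (X : Linfty P) : IsProbabilityMeasure (P.map X) :=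
  Measure.isProbabilityMeasure_map (measurable_coe X).aemeasurable

lemma cdf_eq (X : Linfty P) (x : ℝ) :
    ProbabilityTheory.cdf (P.map X) x = P.real {ω | X ω ≤ x} := by
  rw [ProbabilityTheory.cdf_eq_real, Measure.real, Measure.real,
    Measure.map_apply (measurable_coe X) measurableSet_Iic]
  rfl

lemma cdf_of_le {X : Linfty P} {M x : ℝ} (hM : ∀ᵐ ω ∂P, X ω ≤ M) (hx : M ≤ x) :
    ProbabilityTheory.cdf (P.map X) x = 1 := by
  rw [cdf_eq]
  have : {ω | X ω ≤ x} =ᵐ[P] univ :=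
    Filter.eventuallyEq_univ.2 (hM.mono fun ω h => h.trans hx)
  rw [measureReal_congr this, probReal_univ]

lemma cdf_of_lt {X : Linfty P} {M x : ℝ} (hM : ∀ᵐ ω ∂P, M ≤ X ω) (hx : x < M) :
    ProbabilityTheory.cdf (P.map X) x = 0 := by
  rw [cdf_eq]
  have : {ω | X ω ≤ x} =ᵐ[P] (∅ : Set Ω) :=
    Filter.eventuallyEq_empty.2 (hM.mono fun ω h h' => absurd (h.trans h') (not_le.2 hx))
  rw [measureReal_congr this, measureReal_empty]

lemma mem_quantileSet {X : Linfty P} {M t : ℝ} (hM : ∀ᵐ ω ∂P, |X ω| ≤ M) (ht : t < 1) :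
    M ∈ {x : ℝ | t < ProbabilityTheory.cdf (P.map X) x} := by
  rw [mem_ofPred_eq, cdf_of_le (hM.mono fun ω h => (abs_le.1 h).2) le_rfl]
  exact ht

lemma mem_lowerBounds_quantileSet {X : Linfty P} {M t : ℝ} (hM : ∀ᵐ ω ∂P, |X ω| ≤ M)
    (ht : 0 ≤ t) : -M ∈ lowerBounds {x : ℝ | t < ProbabilityTheory.cdf (P.map X) x} := by
  intro x hx
  by_contra! h
  rw [mem_ofPred_eq, cdf_of_lt (hM.mono fun ω h => (abs_le.1 h).1) h] at hx
  exact absurd hx (not_lt.2 ht)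

lemma quantileSet_nonempty (X : Linfty P) {t : ℝ} (ht : t < 1) :
    {x : ℝ | t < ProbabilityTheory.cdf (P.map X) x}.Nonempty := by
  obtain ⟨M, -, hM⟩ := exists_ae_bound X
  exact ⟨M, mem_quantileSet hM ht⟩

lemma quantileSet_bddBelow (X : Linfty P) {t : ℝ} (ht : 0 ≤ t) :
    BddBelow {x : ℝ | t < ProbabilityTheory.cdf (P.map X) x} := by
  obtain ⟨M, -, hM⟩ := exists_ae_bound X
  exact ⟨-M, mem_lowerBounds_quantileSet hM ht⟩

lemma abs_upperQuantile_le {X : Linfty P} {M : ℝ} (hM : ∀ᵐ ω ∂P, |X ω| ≤ M) {t : ℝ}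
    (ht : t ∈ Ico (0 : ℝ) 1) : |upperQuantile P X t| ≤ M :=
  abs_le.2 ⟨le_csInf (quantileSet_nonempty X ht.2) (mem_lowerBounds_quantileSet hM ht.1),
    csInf_le (quantileSet_bddBelow X ht.1) (mem_quantileSet hM ht.2)⟩

lemma upperQuantile_le_of_lt_cdf (X : Linfty P) {t x : ℝ} (ht : 0 ≤ t)
    (h : t < ProbabilityTheory.cdf (P.map X) x) : upperQuantile P X t ≤ x :=
  csInf_le (quantileSet_bddBelow X ht) h

/-- Right continuity of the distribution function F. With `upperQuantile_le_of_lt_cdf` it traps {q ≤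
x} between the levels t < F(x) and t ≤ F(x), which differ by a null set; this identifies the law of
q. -/
lemma le_cdf_of_upperQuantile_le (X : Linfty P) {t x : ℝ} (ht : t < 1)
    (h : upperQuantile P X t ≤ x) : t ≤ ProbabilityTheory.cdf (P.map X) x := by
  have hr := (ProbabilityTheory.cdf (P.map X)).right_continuous x
  refine ge_of_tendsto (hr.tendsto.mono_left (nhdsWithin_mono x Ioi_subset_Ici_self)) ?_
  filter_upwards [self_mem_nhdsWithin] with y hy
  obtain ⟨z, hz, hzy⟩ := exists_lt_of_csInf_lt (quantileSet_nonempty X ht)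
    (lt_of_le_of_lt h (mem_Ioi.1 hy))
  exact (le_of_lt hz).trans (ProbabilityTheory.monotone_cdf _ hzy.le)

lemma monotoneOn_upperQuantile (X : Linfty P) :
    MonotoneOn (upperQuantile P X) (Ico 0 1) := fun _ hs _ ht hst =>
  csInf_le_csInf (quantileSet_bddBelow X hs.1) (quantileSet_nonempty X ht.2)
    fun _ hx => lt_of_le_of_lt hst hx

/-- Right continuity of q at 0, with s = F(x) > 0. It controls the possible mass at level 0. -/
lemma exists_upperQuantile_le (X : Linfty P) {r : ℝ} (hr : upperQuantile P X 0 < r) :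
    ∃ s ∈ Ioc (0 : ℝ) 1, ∃ x < r, ∀ t ∈ Ico 0 s, upperQuantile P X t ≤ x := by
  obtain ⟨x, hx, hxr⟩ := exists_lt_of_csInf_lt (quantileSet_nonempty X zero_lt_one) hr
  exact ⟨_, ⟨hx, ProbabilityTheory.cdf_le_one _ _⟩, x, hxr, fun t ht =>
    upperQuantile_le_of_lt_cdf X ht.1 ht.2⟩

lemma aemeasurable_upperQuantile (X : Linfty P) :
    AEMeasurable (upperQuantile P X) (volume.restrict (Ioo 0 1)) :=
  aemeasurable_restrict_of_monotoneOn measurableSet_Ioo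
    ((monotoneOn_upperQuantile X).mono Ioo_subset_Ico_self)

instance : IsProbabilityMeasure ((volume : Measure ℝ).restrict (Ioo 0 1)) :=
  ⟨by simp⟩

/-- The quantile function of `X` has the distribution of `X` under Lebesgue measure. -/
lemma map_upperQuantile (X : Linfty P) :
    (volume.restrict (Ioo 0 1)).map (upperQuantile P X) = P.map X := by
  have : IsProbabilityMeasure ((volume.restrict (Ioo 0 1)).map (upperQuantile P X)) :=
    Measure.isProbabilityMeasure_map (aemeasurable_upperQuantile X)
  refine Measure.ext_of_Iic _ _ fun x => ?_
  rw [← ProbabilityTheory.ofReal_cdf (P.map X),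
    Measure.map_apply_of_aemeasurable (aemeasurable_upperQuantile X) measurableSet_Iic]
  set c := ProbabilityTheory.cdf (P.map X) x
  have hc0 : 0 ≤ c := ProbabilityTheory.cdf_nonneg _ _
  have hc1 : c ≤ 1 := ProbabilityTheory.cdf_le_one _ _
  refine le_antisymm ?_ ?_
  · calc (volume.restrict (Ioo 0 1)) (upperQuantile P X ⁻¹' Iic x)
        ≤ (volume.restrict (Ioo 0 1)) (Iic c) := by
          refine measure_mono_ae ?_
          filter_upwards [ae_restrict_mem measurableSet_Ioo] with t ht h
          exact le_cdf_of_upperQuantile_le X ht.2 h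
      _ = volume (Iic c ∩ Ioo 0 1) := Measure.restrict_apply measurableSet_Iic
      _ ≤ volume (Icc 0 c) := measure_mono fun t ht => ⟨ht.2.1.le, ht.1⟩
      _ = ENNReal.ofReal c := by simp
  · calc ENNReal.ofReal c = volume (Ioo 0 c) := by simp
      _ ≤ volume (Iio c ∩ Ioo 0 1) :=
          measure_mono fun t ht => ⟨ht.2, ht.1, ht.2.trans_le hc1⟩
      _ = (volume.restrict (Ioo 0 1)) (Iio c) := (Measure.restrict_apply measurableSet_Iio).symm
      _ ≤ (volume.restrict (Ioo 0 1)) (upperQuantile P X ⁻¹' Iic x) := by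
          refine measure_mono_ae ?_
          filter_upwards [ae_restrict_mem measurableSet_Ioo] with t ht h
          exact upperQuantile_le_of_lt_cdf X ht.1.le h

lemma integral_comp_eq_integral_upperQuantile (X : Linfty P) {f : ℝ → ℝ} (hf : Continuous f) :
    ∫ ω, f (X ω) ∂P = ∫ t in Ioo (0 : ℝ) 1, f (upperQuantile P X t) := by
  rw [← integral_map (measurable_coe X).aemeasurable hf.aestronglyMeasurable,
    ← map_upperQuantile X,
    integral_map (aemeasurable_upperQuantile X) hf.aestronglyMeasurable]

/-- Serves translations and scalings by a > 0 alike; a = 0 is no order isomorphism and is treated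
apart in `upperQuantile_smul`. -/
lemma upperQuantile_orderIso {X Y : Linfty P} (e : ℝ ≃o ℝ) (h : ∀ᵐ ω ∂P, Y ω = e (X ω))
    {t : ℝ} (ht : t ∈ Ico (0 : ℝ) 1) : upperQuantile P Y t = e (upperQuantile P X t) := by
  have hF (x : ℝ) : ProbabilityTheory.cdf (P.map Y) x
      = ProbabilityTheory.cdf (P.map X) (e.symm x) := by
    rw [cdf_eq, cdf_eq]
    refine measureReal_congr ?_
    filter_upwards [h] with ω hω
    change (Y ω ≤ x) = (X ω ≤ e.symm x)
    rw [hω, e.le_symm_apply]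
  rw [upperQuantile, upperQuantile,
    e.map_csInf' (quantileSet_nonempty X ht.2) (quantileSet_bddBelow X ht.1)]
  congr 1
  ext x
  rw [e.image_eq_preimage_symm]
  simp only [mem_ofPred_eq, mem_preimage, hF]

lemma coe_add_const (X : Linfty P) (m : ℝ) :
    ∀ᵐ ω ∂P, (X + Lp.const ⊤ P m : Linfty P) ω = X ω + m := by
  filter_upwards [Lp.coeFn_add X (Lp.const ⊤ P m), Lp.coeFn_const (p := ⊤) (μ := P) m] with ω h h'
  rw [h, Pi.add_apply, h', Function.const_apply]

lemma upperQuantile_add_const (X : Linfty P) (m : ℝ) {t : ℝ} (ht : t ∈ Ico (0 : ℝ) 1) :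
    upperQuantile P (X + Lp.const ⊤ P m) t = upperQuantile P X t + m :=
  upperQuantile_orderIso (OrderIso.addRight m) (coe_add_const X m) ht

lemma upperQuantile_zero {t : ℝ} (ht : t ∈ Ico (0 : ℝ) 1) :
    upperQuantile P (0 : Linfty P) t = 0 := by
  have h0 : ∀ᵐ ω ∂P, |(0 : Linfty P) ω| ≤ 0 := by
    filter_upwards [Lp.coeFn_zero ℝ ⊤ P] with ω h
    rw [h]; simp
  exact abs_nonpos_iff.1 (abs_upperQuantile_le h0 ht)

lemma upperQuantile_smul (X : Linfty P) {a : ℝ} (ha : 0 ≤ a) {t : ℝ} (ht : t ∈ Ico (0 : ℝ) 1) :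
    upperQuantile P (a • X) t = a * upperQuantile P X t := by
  rcases ha.eq_or_lt with rfl | ha
  · rw [zero_smul, upperQuantile_zero ht, zero_mul]
  · exact upperQuantile_orderIso (OrderIso.mulLeft₀ a ha)
      ((Lp.coeFn_smul a X).mono fun ω h => by simpa using h) ht

lemma quantile_one (X : Linfty P) :
    quantile P X 1 = sSup (upperQuantile P X '' Ioo 0 1) := by
  obtain ⟨M, -, hM⟩ := exists_ae_bound X
  rw [quantile, if_neg (lt_irrefl _)]
  refine leftLim_eq_of_tendsto (MonotoneOn.tendsto_nhdsWithin_Ioo_left ⟨1 / 2, by norm_num⟩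
    ((monotoneOn_upperQuantile X).mono Ioo_subset_Ico_self) ⟨M, ?_⟩)
  rintro _ ⟨t, ht, rfl⟩
  exact (abs_le.1 (abs_upperQuantile_le hM (Ioo_subset_Ico_self ht))).2

lemma abs_VaR_le {X : Linfty P} {M : ℝ} (hM : ∀ᵐ ω ∂P, |X ω| ≤ M) (t : I) :
    |VaR P X t| ≤ M := by
  have hb (u : ℝ) (hu : u ∈ Ioo (0 : ℝ) 1) := abs_le.1 (abs_upperQuantile_le hM (Ioo_subset_Ico_self hu))
  rcases t.2.2.eq_or_lt with h | h
  · have hh : (1 / 2 : ℝ) ∈ Ioo (0 : ℝ) 1 := by norm_num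
    have hbdd : BddAbove (upperQuantile P X '' Ioo 0 1) := by
      refine ⟨M, ?_⟩
      rintro _ ⟨u, hu, rfl⟩
      exact (hb u hu).2
    rw [VaR, h, quantile_one, abs_neg, abs_le]
    refine ⟨(hb _ hh).1.trans (le_csSup hbdd (mem_image_of_mem _ hh)),
      csSup_le ⟨_, mem_image_of_mem _ hh⟩ ?_⟩
    rintro _ ⟨u, hu, rfl⟩
    exact (hb u hu).2
  · rw [VaR_of_lt_one X h, abs_neg]
    exact abs_upperQuantile_le hM ⟨t.2.1, h⟩

lemma antitone_VaR (X : Linfty P) : Antitone fun t : I => VaR P X t := by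
  intro s t hst
  have hst' : (s : ℝ) ≤ t := hst
  obtain ⟨M, -, hM⟩ := exists_ae_bound X
  rcases s.2.2.eq_or_lt with hs | hs
  · rw [show t = s from le_antisymm (show (t : ℝ) ≤ s from hs ▸ t.2.2) hst]
  beta_reduce
  rw [VaR_of_lt_one X hs]
  rcases t.2.2.eq_or_lt with ht | ht
  · rw [VaR, ht, quantile_one, neg_le_neg_iff]
    have hm : ((s : ℝ) + 1) / 2 ∈ Ioo (0 : ℝ) 1 :=
      ⟨by linarith [s.2.1], by linarith⟩
    have hbdd : BddAbove (upperQuantile P X '' Ioo 0 1) := by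
      refine ⟨M, ?_⟩
      rintro _ ⟨u, hu, rfl⟩
      exact (abs_le.1 (abs_upperQuantile_le hM (Ioo_subset_Ico_self hu))).2
    refine le_trans ?_ (le_csSup hbdd (mem_image_of_mem _ hm))
    exact monotoneOn_upperQuantile X ⟨s.2.1, hs⟩ (Ioo_subset_Ico_self hm) (by linarith)
  · rw [VaR_of_lt_one X ht, neg_le_neg_iff]
    exact monotoneOn_upperQuantile X ⟨s.2.1, hs⟩ ⟨t.2.1, ht⟩ hst'

lemma measurable_VaR (X : Linfty P) : Measurable fun t : I => VaR P X t :=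
  (antitone_VaR X).measurable

lemma integrable_VaR (X : Linfty P) (μ : Measure I) [IsFiniteMeasure μ] :
    Integrable (fun t : I => VaR P X t) μ := by
  obtain ⟨M, -, hM⟩ := exists_ae_bound X
  exact Integrable.of_bound (measurable_VaR X).aestronglyMeasurable M
    (Filter.Eventually.of_forall fun t => abs_VaR_le hM t)

end Quantile

/-! ### Integrals against decreasing densities -/

section Antitone

lemma exists_Ioo_subset_superlevel {h : ℝ → ℝ} (hh : AntitoneOn h (Ioo 0 1)) (y : ℝ) :
    ∃ s ∈ Icc (0 : ℝ) 1, Ioo 0 s ⊆ {t | y < h t} ∩ Ioo 0 1 ∧ {t | y < h t} ∩ Ioo 0 1 ⊆ Ioc 0 s := by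
  set L := {t | y < h t} ∩ Ioo (0 : ℝ) 1
  have hb : BddAbove L := ⟨1, fun t ht => ht.2.2.le⟩
  have h1 : sSup L ≤ 1 := Real.sSup_le (fun t ht => ht.2.2.le) zero_le_one
  -- When L is empty, the convention `sSup ∅ = 0` yields the empty interval, as needed.
  refine ⟨sSup L, ⟨Real.sSup_nonneg fun t ht => ht.2.1.le, h1⟩, ?_, ?_⟩
  · intro t ht
    have hne : L.Nonempty := by
      by_contra! he
      rw [he, Real.sSup_empty] at ht
      exact absurd (ht.1.trans ht.2) (lt_irrefl _)
    obtain ⟨u, hu, htu⟩ := exists_lt_of_lt_csSup hne ht.2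
    have htT : t ∈ Ioo (0 : ℝ) 1 := ⟨ht.1, ht.2.trans_le h1⟩
    exact ⟨lt_of_lt_of_le hu.1 (hh htT hu.2 htu.le), htT⟩
  · exact fun t ht => ⟨ht.2.1, le_csSup hb ht⟩

lemma exists_superlevel_ae_eq_Ioo {h : ℝ → ℝ} (hh : AntitoneOn h (Ioo 0 1)) (y : ℝ) :
    ∃ s ∈ Icc (0 : ℝ) 1, ({t | y < h t} ∩ Ioo 0 1 : Set ℝ) =ᵐ[volume] Ioo 0 s := by
  obtain ⟨s, hs, h1, h2⟩ := exists_Ioo_subset_superlevel hh y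
  exact ⟨s, hs, (h2.eventuallyLE.trans Ioo_ae_eq_Ioc.symm.le).antisymm h1.eventuallyLE⟩

lemma aemeasurable_of_antitoneOn {h : ℝ → ℝ} (hh : AntitoneOn h (Ioo 0 1)) :
    AEMeasurable h (volume.restrict (Ioo 0 1)) :=
  aemeasurable_restrict_of_antitoneOn measurableSet_Ioo hh

/-- Layer-cake formula for h under the measure χ dt. Its superlevel sets are initial intervals, so
integrals against h are determined by integrals over such intervals. -/
lemma lintegral_mul_eq_lintegral_superlevel {h : ℝ → ℝ} (hh : AntitoneOn h (Ioo 0 1))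
    (h0 : ∀ t ∈ Ioo (0 : ℝ) 1, 0 ≤ h t) {χ : ℝ → ENNReal}
    (hχ : AEMeasurable χ (volume.restrict (Ioo 0 1))) :
    ∫⁻ t in Ioo 0 1, χ t * ENNReal.ofReal (h t)
      = ∫⁻ y in Ioi (0 : ℝ), ∫⁻ t in {t | y < h t} ∩ Ioo 0 1, χ t := by
  have hm := aemeasurable_of_antitoneOn hh
  have hac := withDensity_absolutelyContinuous (volume.restrict (Ioo (0 : ℝ) 1)) χ
  have h1 := lintegral_withDensity_eq_lintegral_mul₀ hχ hm.ennreal_ofReal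
  simp only [Pi.mul_apply] at h1
  rw [← h1, lintegral_eq_lintegral_meas_lt]
  · refine lintegral_congr fun y => ?_
    have hnm : NullMeasurableSet {t | y < h t} (volume.restrict (Ioo (0 : ℝ) 1)) :=
      nullMeasurableSet_lt aemeasurable_const hm
    rw [withDensity_apply₀ _ hnm, Measure.restrict_restrict₀ hnm]
  · exact hac.ae_le (show ∀ᵐ t ∂(volume.restrict (Ioo (0 : ℝ) 1)), (0 : ℝ) ≤ h t from
      (ae_restrict_mem measurableSet_Ioo).mono h0)
  · exact hm.mono_ac hac

/-- If the integrals of `φ` over all initial intervals are at most those of `ψ`, then so are the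
integrals against a nonnegative decreasing density. -/
lemma setIntegral_mul_le_of_antitoneOn {φ ψ h : ℝ → ℝ} {M : ℝ}
    (hφm : AEMeasurable φ (volume.restrict (Ioo 0 1))) (hφ : ∀ t ∈ Ioo (0 : ℝ) 1, |φ t| ≤ M)
    (hψm : AEMeasurable ψ (volume.restrict (Ioo 0 1))) (hψ : ∀ t ∈ Ioo (0 : ℝ) 1, |ψ t| ≤ M)
    (hh : AntitoneOn h (Ioo 0 1)) (h0 : ∀ t ∈ Ioo (0 : ℝ) 1, 0 ≤ h t)
    (hi : IntegrableOn h (Ioo 0 1))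
    (hle : ∀ s ∈ Ioc (0 : ℝ) 1, ∫ t in Ioo 0 s, φ t ≤ ∫ t in Ioo 0 s, ψ t) :
    ∫ t in Ioo 0 1, φ t * h t ≤ ∫ t in Ioo 0 1, ψ t * h t := by
  have hint (χ : ℝ → ℝ) (hχm : AEMeasurable χ (volume.restrict (Ioo 0 1)))
      (hχ : ∀ t ∈ Ioo (0 : ℝ) 1, |χ t| ≤ M) (s : ℝ) (hs : s ≤ 1) :
      IntegrableOn χ (Ioo 0 s) :=
    (show IntegrableOn χ (Ioo 0 1) from Integrable.of_bound hχm.aestronglyMeasurable M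
      ((ae_restrict_mem measurableSet_Ioo).mono hχ)).mono_set (Ioo_subset_Ioo_right hs)
  have hinth (χ : ℝ → ℝ) (hχm : AEMeasurable χ (volume.restrict (Ioo 0 1)))
      (hχ : ∀ t ∈ Ioo (0 : ℝ) 1, |χ t| ≤ M) :
      IntegrableOn (fun t => χ t * h t) (Ioo 0 1) :=
    Integrable.bdd_mul hi hχm.aestronglyMeasurable
      ((ae_restrict_mem measurableSet_Ioo).mono hχ)
  -- Adding M makes both integrands nonnegative, so the layer-cake formula applies; the added term M
  -- ∫ h is the same on both sides and cancels at the end.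
  have hlevel (s : ℝ) (hs : s ∈ Icc (0 : ℝ) 1) :
      ∫⁻ t in Ioo 0 s, ENNReal.ofReal (φ t + M) ≤ ∫⁻ t in Ioo 0 s, ENNReal.ofReal (ψ t + M) := by
    rcases hs.1.eq_or_lt with rfl | hs0
    · simp
    have hc : IntegrableOn (fun _ : ℝ => M) (Ioo 0 s) := by simp
    have hnn (χ : ℝ → ℝ) (hχ : ∀ t ∈ Ioo (0 : ℝ) 1, |χ t| ≤ M) :
        0 ≤ᵐ[volume.restrict (Ioo 0 s)] fun t => χ t + M := by
      filter_upwards [ae_restrict_mem measurableSet_Ioo] with t ht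
      have := (abs_le.1 (hχ t ⟨ht.1, ht.2.trans_le hs.2⟩)).1
      change 0 ≤ χ t + M
      linarith
    have iφ : IntegrableOn (fun t => φ t + M) (Ioo 0 s) := (hint φ hφm hφ s hs.2).add hc
    have iψ : IntegrableOn (fun t => ψ t + M) (Ioo 0 s) := (hint ψ hψm hψ s hs.2).add hc
    rw [← ofReal_integral_eq_lintegral_ofReal iφ (hnn φ hφ),
      ← ofReal_integral_eq_lintegral_ofReal iψ (hnn ψ hψ),
      integral_add (hint φ hφm hφ s hs.2) hc, integral_add (hint ψ hψm hψ s hs.2) hc]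
    exact ENNReal.ofReal_le_ofReal (add_le_add (hle s ⟨hs0, hs.2⟩) le_rfl)
  have hL : ∫⁻ t in Ioo 0 1, ENNReal.ofReal (φ t + M) * ENNReal.ofReal (h t)
      ≤ ∫⁻ t in Ioo 0 1, ENNReal.ofReal (ψ t + M) * ENNReal.ofReal (h t) := by
    rw [lintegral_mul_eq_lintegral_superlevel hh h0 (hφm.add_const M).ennreal_ofReal,
      lintegral_mul_eq_lintegral_superlevel hh h0 (hψm.add_const M).ennreal_ofReal]
    refine lintegral_mono fun y => ?_
    obtain ⟨s, hs, he⟩ := exists_superlevel_ae_eq_Ioo hh y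
    beta_reduce
    rw [Measure.restrict_congr_set he]
    exact hlevel s hs
  have hconv (χ : ℝ → ℝ) (hχm : AEMeasurable χ (volume.restrict (Ioo 0 1)))
      (hχ : ∀ t ∈ Ioo (0 : ℝ) 1, |χ t| ≤ M) :
      ∫⁻ t in Ioo 0 1, ENNReal.ofReal (χ t + M) * ENNReal.ofReal (h t)
        = ENNReal.ofReal ((∫ t in Ioo 0 1, χ t * h t) + M * ∫ t in Ioo 0 1, h t) ∧
      0 ≤ (∫ t in Ioo 0 1, χ t * h t) + M * ∫ t in Ioo 0 1, h t := by
    have hnn : ∀ t ∈ Ioo (0 : ℝ) 1, 0 ≤ χ t + M := fun t ht => by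
      have := (abs_le.1 (hχ t ht)).1
      linarith
    have e : (∫ t in Ioo 0 1, χ t * h t) + M * ∫ t in Ioo 0 1, h t
        = ∫ t in Ioo 0 1, (χ t * h t + M * h t) := by
      rw [integral_add (hinth χ hχm hχ) (hi.const_mul M), integral_const_mul]
    have hnn' : 0 ≤ᵐ[volume.restrict (Ioo (0 : ℝ) 1)] fun t => χ t * h t + M * h t := by
      filter_upwards [ae_restrict_mem measurableSet_Ioo] with t ht
      change 0 ≤ χ t * h t + M * h t
      rw [← add_mul]
      exact mul_nonneg (hnn t ht) (h0 t ht)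
    have hadd : IntegrableOn (fun t => χ t * h t + M * h t) (Ioo 0 1) :=
      (hinth χ hχm hχ).add (hi.const_mul M)
    rw [e, ofReal_integral_eq_lintegral_ofReal hadd hnn']
    refine ⟨setLIntegral_congr_fun measurableSet_Ioo fun t ht => ?_, integral_nonneg_of_ae hnn'⟩
    rw [← ENNReal.ofReal_mul (hnn t ht), add_mul]
  rw [(hconv φ hφm hφ).1, (hconv ψ hψm hψ).1,
    ENNReal.ofReal_le_ofReal_iff (hconv ψ hψm hψ).2] at hL
  linarith

end Antitone

/-! ### Second-order stochastic dominance in terms of quantiles -/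

section Dominance

variable {Ω : Type*} [MeasurableSpace Ω] {P : Measure Ω}

/-- The integrated quantile functions of `Y` lie below those of `X`. -/
def IntegratedQuantileLE (P : Measure Ω) (Y X : Linfty P) : Prop :=
  ∀ s ∈ Ioc (0 : ℝ) 1,
    ∫ t in Ioo 0 s, upperQuantile P Y t ≤ ∫ t in Ioo 0 s, upperQuantile P X t

variable [IsProbabilityMeasure P]

lemma integrableOn_upperQuantile (X : Linfty P) : IntegrableOn (upperQuantile P X) (Ioo 0 1) := by
  obtain ⟨M, -, hM⟩ := exists_ae_bound X
  exact Integrable.of_bound (aemeasurable_upperQuantile X).aestronglyMeasurable M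
    ((ae_restrict_mem measurableSet_Ioo).mono
      fun t ht => abs_upperQuantile_le hM (Ioo_subset_Ico_self ht))

lemma integrableOn_upperQuantile_mul (X : Linfty P) {h : ℝ → ℝ} (hi : IntegrableOn h (Ioo 0 1)) :
    IntegrableOn (fun t => upperQuantile P X t * h t) (Ioo 0 1) := by
  obtain ⟨M, -, hM⟩ := exists_ae_bound X
  exact Integrable.bdd_mul hi (aemeasurable_upperQuantile X).aestronglyMeasurable
    ((ae_restrict_mem measurableSet_Ioo).mono
      fun t ht => abs_upperQuantile_le hM (Ioo_subset_Ico_self ht))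

lemma IntegratedQuantileLE.setIntegral_mul_le {X Y : Linfty P} (hXY : IntegratedQuantileLE P Y X)
    {h : ℝ → ℝ} (hh : AntitoneOn h (Ioo 0 1)) (h0 : ∀ t ∈ Ioo (0 : ℝ) 1, 0 ≤ h t)
    (hi : IntegrableOn h (Ioo 0 1)) :
    ∫ t in Ioo 0 1, upperQuantile P Y t * h t ≤ ∫ t in Ioo 0 1, upperQuantile P X t * h t := by
  obtain ⟨M, -, hM⟩ := exists_ae_bound X
  obtain ⟨N, -, hN⟩ := exists_ae_bound Y
  exact setIntegral_mul_le_of_antitoneOn (M := max M N) (aemeasurable_upperQuantile Y)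
    (fun t ht => (abs_upperQuantile_le hN (Ioo_subset_Ico_self ht)).trans (le_max_right _ _))
    (aemeasurable_upperQuantile X)
    (fun t ht => (abs_upperQuantile_le hM (Ioo_subset_Ico_self ht)).trans (le_max_left _ _))
    hh h0 hi hXY

/-- The means of q over (0, s) tend to q(0) as s decreases to 0; the strict gap is contradicted on
one short interval. -/
lemma IntegratedQuantileLE.upperQuantile_zero_le {X Y : Linfty P}
    (hXY : IntegratedQuantileLE P Y X) : upperQuantile P Y 0 ≤ upperQuantile P X 0 := by
  by_contra! hlt
  obtain ⟨s, hs, x, hx, hq⟩ := exists_upperQuantile_le X hlt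
  have hsub : Ioo 0 s ⊆ Ioo (0 : ℝ) 1 := Ioo_subset_Ioo_right hs.2
  have hc (c : ℝ) : IntegrableOn (fun _ : ℝ => c) (Ioo 0 s) := by simp
  have h1 : ∫ t in Ioo 0 s, upperQuantile P X t ≤ ∫ t in Ioo 0 s, x :=
    setIntegral_mono_on ((integrableOn_upperQuantile X).mono_set hsub) (hc x) measurableSet_Ioo
      fun t ht => hq t (Ioo_subset_Ico_self ht)
  have h2 : ∫ t in Ioo 0 s, upperQuantile P Y 0 ≤ ∫ t in Ioo 0 s, upperQuantile P Y t :=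
    setIntegral_mono_on (hc _) ((integrableOn_upperQuantile Y).mono_set hsub) measurableSet_Ioo
      fun t ht => monotoneOn_upperQuantile Y ⟨le_rfl, zero_lt_one⟩
        (Ioo_subset_Ico_self (hsub ht)) ht.1.le
  have h3 := (h2.trans (hXY s hs)).trans h1
  simp only [setIntegral_const, Real.volume_real_Ioo_of_le hs.1.le, smul_eq_mul, sub_zero] at h3
  exact absurd (le_of_mul_le_mul_left h3 hs.1) (not_le.2 hx)

/-- Half of the conjugacy between s ↦ ∫_0^s q and c ↦ E(c - X)⁺: the integrand c - q lies below its
positive part. The next lemma supplies a c giving equality. -/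
lemma setIntegral_sub_upperQuantile_le (X : Linfty P) (c : ℝ) {s : ℝ} (hs : s ∈ Ioc (0 : ℝ) 1) :
    s * c - ∫ t in Ioo 0 s, upperQuantile P X t ≤ ∫ ω, max (c - X ω) 0 ∂P := by
  have hsub : Ioo 0 s ⊆ Ioo (0 : ℝ) 1 := Ioo_subset_Ioo_right hs.2
  have hc : IntegrableOn (fun _ : ℝ => c) (Ioo 0 1) := by simp
  have hi := (integrableOn_upperQuantile X)
  have hp : IntegrableOn (fun t => max (c - upperQuantile P X t) 0) (Ioo 0 1) :=
    (hc.sub hi).sup (integrable_zero _ _ _)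
  rw [integral_comp_eq_integral_upperQuantile X (f := fun x => max (c - x) 0) (by fun_prop)]
  calc s * c - ∫ t in Ioo 0 s, upperQuantile P X t
      = ∫ t in Ioo 0 s, (c - upperQuantile P X t) := by
        rw [integral_sub (hc.mono_set hsub) (hi.mono_set hsub)]
        simp [Real.volume_real_Ioo_of_le hs.1.le]
    _ ≤ ∫ t in Ioo 0 s, max (c - upperQuantile P X t) 0 :=
        integral_mono ((hc.mono_set hsub).sub (hi.mono_set hsub)) (hp.mono_set hsub)
          fun t => le_max_left _ _
    _ ≤ ∫ t in Ioo 0 1, max (c - upperQuantile P X t) 0 :=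
        setIntegral_mono_set hp (Filter.Eventually.of_forall fun t => le_max_right _ _)
          hsub.eventuallyLE

lemma exists_setIntegral_sub_upperQuantile_eq (X : Linfty P) {s : ℝ} (hs : s ∈ Ioc (0 : ℝ) 1) :
    ∃ c, ∫ ω, max (c - X ω) 0 ∂P = s * c - ∫ t in Ioo 0 s, upperQuantile P X t := by
  obtain ⟨M, -, hM⟩ := exists_ae_bound X
  have hsub : Ioo 0 s ⊆ Ioo (0 : ℝ) 1 := Ioo_subset_Ioo_right hs.2
  -- The optimal c is q(s), where c - q changes sign; at s = 1 any upper bound of q serves.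
  obtain ⟨c, hc1, hc2⟩ : ∃ c, (∀ t ∈ Ioo 0 s, upperQuantile P X t ≤ c) ∧
      ∀ t ∈ Ico s 1, c ≤ upperQuantile P X t := by
    rcases hs.2.eq_or_lt with rfl | h1
    · exact ⟨M, fun t ht => (abs_le.1 (abs_upperQuantile_le hM (Ioo_subset_Ico_self ht))).2,
        fun t ht => absurd (ht.1.trans_lt ht.2) (lt_irrefl _)⟩
    · exact ⟨upperQuantile P X s, fun t ht => monotoneOn_upperQuantile X
        (Ioo_subset_Ico_self (hsub ht)) ⟨hs.1.le, h1⟩ ht.2.le,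
        fun t ht => monotoneOn_upperQuantile X ⟨hs.1.le, h1⟩ ⟨hs.1.le.trans ht.1, ht.2⟩ ht.1⟩
  have hc : IntegrableOn (fun _ : ℝ => c) (Ioo 0 s) := by simp
  refine ⟨c, ?_⟩
  rw [integral_comp_eq_integral_upperQuantile X (f := fun x => max (c - x) 0) (by fun_prop)]
  calc ∫ t in Ioo 0 1, max (c - upperQuantile P X t) 0
      = ∫ t in Ioo 0 1, (Ioo 0 s).indicator (fun t => c - upperQuantile P X t) t := by
        refine setIntegral_congr_fun measurableSet_Ioo fun t ht => ?_
        rcases lt_or_ge t s with h | h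
        · rw [indicator_of_mem (show t ∈ Ioo 0 s from ⟨ht.1, h⟩)]
          exact max_eq_left (sub_nonneg.2 (hc1 t ⟨ht.1, h⟩))
        · rw [indicator_of_notMem (fun h' => absurd h'.2 (not_lt.2 h))]
          exact max_eq_right (sub_nonpos.2 (hc2 t ⟨h, ht.2⟩))
    _ = ∫ t in Ioo 0 s, (c - upperQuantile P X t) := by
        rw [setIntegral_indicator measurableSet_Ioo, inter_eq_self_of_subset_right hsub]
    _ = s * c - ∫ t in Ioo 0 s, upperQuantile P X t := by
        rw [integral_sub hc ((integrableOn_upperQuantile X).mono_set hsub)]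
        simp [Real.volume_real_Ioo_of_le hs.1.le]

/-- Test dominance with x ↦ -(c - x)⁺, where c is optimal for Y at level s; for X the conjugacy
inequality suffices. -/
lemma SSD.integratedQuantileLE {X Y : Linfty P} (h : SSD P X Y) : IntegratedQuantileLE P Y X := by
  intro s hs
  obtain ⟨c, hc⟩ := exists_setIntegral_sub_upperQuantile_eq Y hs
  have h1 := setIntegral_sub_upperQuantile_le X c hs
  have hmono : Monotone fun x : ℝ => -max (c - x) 0 := fun x y hxy =>
    neg_le_neg (max_le_max (sub_le_sub_left hxy c) le_rfl)
  have hconc : ConcaveOn ℝ univ fun x : ℝ => -max (c - x) 0 :=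
    (((convexOn_const c convex_univ).sub (concaveOn_id convex_univ)).sup
      (convexOn_const 0 convex_univ)).neg
  have h2 := h _ hmono hconc
  rw [integral_neg, integral_neg] at h2
  linarith

/-- The right derivative is a nonnegative decreasing supergradient of an increasing concave
function. -/
lemma exists_supergradient {f : ℝ → ℝ} (hf : Monotone f) (hc : ConcaveOn ℝ univ f) :
    ∃ f' : ℝ → ℝ, Antitone f' ∧ (∀ x, 0 ≤ f' x) ∧ ∀ x y, f y ≤ f x + f' x * (y - x) := by
  have hv : ConvexOn ℝ univ (-f) := hc.neg
  have hi (x : ℝ) : x ∈ interior (univ : Set ℝ) := by simp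
  have hgrad (x y : ℝ) : -f x + derivWithin (-f) (Ioi x) x * (y - x) ≤ -f y := by
    rcases lt_trichotomy x y with h | h | h
    · have := hv.rightDeriv_le_slope_of_mem_interior (hi x) (mem_univ y) h
      rw [slope_def_field, le_div_iff₀ (sub_pos.2 h)] at this
      simp only [Pi.neg_apply] at this
      linarith
    · simp [h]
    · have h1 := hv.slope_le_leftDeriv_of_mem_interior (mem_univ y) (hi x) h
      have h2 := h1.trans (hv.leftDeriv_le_rightDeriv_of_mem_interior (hi x))
      rw [slope_def_field, div_le_iff₀ (sub_pos.2 h)] at h2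
      simp only [Pi.neg_apply] at h2
      linarith
  refine ⟨fun x => -derivWithin (-f) (Ioi x) x, fun x y hxy => neg_le_neg ?_, fun x => ?_,
    fun x y => by linarith [hgrad x y]⟩
  · have := hv.monotoneOn_rightDeriv
    rw [interior_univ] at this
    exact this (mem_univ x) (mem_univ y) hxy
  · have h1 := hgrad x (x + 1)
    have h2 := hf (le_add_of_nonneg_right zero_le_one : x ≤ x + 1)
    beta_reduce
    linarith

/-- By concavity f(q_Y) ≤ f(q_X) + f'(q_X)(q_Y - q_X). Since f' is decreasing and q_X increasing,
f'(q_X) is a nonnegative decreasing density, so the last term has integral at most 0. -/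
lemma IntegratedQuantileLE.ssd {X Y : Linfty P} (h : IntegratedQuantileLE P Y X) : SSD P X Y := by
  intro f hf hc
  obtain ⟨f', hanti, hnn, hgrad⟩ := exists_supergradient hf hc
  have hcont : Continuous f := continuousOn_univ.1 (hc.continuousOn isOpen_univ)
  rw [integral_comp_eq_integral_upperQuantile X hcont,
    integral_comp_eq_integral_upperQuantile Y hcont]
  have hbdd (Z : Linfty P) : IntegrableOn (fun t => f (upperQuantile P Z t)) (Ioo 0 1) := by
    obtain ⟨M, -, hM⟩ := exists_ae_bound Z
    refine Integrable.of_bound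
      (hf.measurable.comp_aemeasurable (aemeasurable_upperQuantile Z)).aestronglyMeasurable
      (max |f M| |f (-M)|) ?_
    filter_upwards [ae_restrict_mem measurableSet_Ioo] with t ht
    have hb := abs_le.1 (abs_upperQuantile_le hM (Ioo_subset_Ico_self ht))
    exact (abs_le_max_abs_abs (hf hb.1) (hf hb.2)).trans (max_comm _ _).le
  have hh : AntitoneOn (fun t => f' (upperQuantile P X t)) (Ioo 0 1) := fun s hs t ht hst =>
    hanti (monotoneOn_upperQuantile X (Ioo_subset_Ico_self hs) (Ioo_subset_Ico_self ht) hst)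
  have hi : IntegrableOn (fun t => f' (upperQuantile P X t)) (Ioo 0 1) := by
    obtain ⟨M, -, hM⟩ := exists_ae_bound X
    refine Integrable.of_bound (aemeasurable_of_antitoneOn hh).aestronglyMeasurable (f' (-M)) ?_
    filter_upwards [ae_restrict_mem measurableSet_Ioo] with t ht
    rw [Real.norm_eq_abs, abs_of_nonneg (hnn _)]
    exact hanti (abs_le.1 (abs_upperQuantile_le hM (Ioo_subset_Ico_self ht))).1
  have hmul := h.setIntegral_mul_le hh (fun t _ => hnn _) hi
  have hX := integrableOn_upperQuantile_mul X hi
  have hY := integrableOn_upperQuantile_mul Y hi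
  have hle : ∫ t in Ioo 0 1, f (upperQuantile P Y t)
      ≤ ∫ t in Ioo 0 1, (f (upperQuantile P X t)
        + (upperQuantile P Y t * f' (upperQuantile P X t)
          - upperQuantile P X t * f' (upperQuantile P X t))) := by
    refine integral_mono (hbdd Y) ((hbdd X).add (hY.sub hX)) fun t => ?_
    have := hgrad (upperQuantile P X t) (upperQuantile P Y t)
    beta_reduce
    linarith
  have hsub : IntegrableOn (fun t => upperQuantile P Y t * f' (upperQuantile P X t)
      - upperQuantile P X t * f' (upperQuantile P X t)) (Ioo 0 1) := hY.sub hX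
  rw [integral_add (hbdd X) hsub, integral_sub hY hX] at hle
  linarith

end Dominance

/-! ### Spectral functionals -/

section Spectral

variable {Ω : Type*} [MeasurableSpace Ω] {P : Measure Ω}

/-- Functionals that average the value at risk with weight `c` at level `0` and a decreasing
density `h` on `(0, 1)`. -/
def IsSpectral (P : Measure Ω) (Φ : Linfty P → ℝ) : Prop :=
  ∃ (c : ℝ) (h : ℝ → ℝ), 0 ≤ c ∧ AntitoneOn h (Ioo 0 1) ∧ (∀ t ∈ Ioo (0 : ℝ) 1, 0 ≤ h t) ∧
    IntegrableOn h (Ioo 0 1) ∧ c + ∫ t in Ioo 0 1, h t = 1 ∧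
    ∀ X : Linfty P, Φ X = -(c * upperQuantile P X 0 + ∫ t in Ioo 0 1, upperQuantile P X t * h t)

lemma isSpectral_density {g : Ioo (0 : ℝ) 1 → ℝ} (hg : g ∈ decreasingDensities) :
    IsSpectral P fun X : Linfty P => ∫ t : Ioo (0 : ℝ) 1, VaR P X t * g t ∂lebesgue := by
  obtain ⟨-, g0, g1, ga⟩ := hg
  let h : ℝ → ℝ := fun t => if ht : t ∈ Ioo (0 : ℝ) 1 then g ⟨t, ht⟩ else 0
  have hgh (t : Ioo (0 : ℝ) 1) : h t = g t := dif_pos t.2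
  have hint : ∫ t in Ioo 0 1, h t = 1 := by
    rw [← integral_subtype_comap measurableSet_Ioo]
    refine Eq.trans ?_ g1
    exact integral_congr_ae (Filter.Eventually.of_forall hgh)
  refine ⟨0, h, le_rfl, fun s hs t ht hst => ?_, fun t ht => ?_, ?_, by rw [hint, zero_add],
    fun X => ?_⟩
  · have : h t = g ⟨t, ht⟩ := dif_pos ht
    have : h s = g ⟨s, hs⟩ := dif_pos hs
    simp only [*]
    exact ga hst
  · rw [show h t = g ⟨t, ht⟩ from dif_pos ht]
    exact g0 _
  -- A non-integrable function has integral 0 by convention, so total mass 1 forces integrability.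
  · by_contra hni
    rw [integral_undef hni] at hint
    exact zero_ne_one hint
  · rw [zero_mul, zero_add, ← integral_neg, ← integral_subtype_comap measurableSet_Ioo]
    refine integral_congr_ae (Filter.Eventually.of_forall fun t => ?_)
    beta_reduce
    rw [hgh, VaR_of_lt_one X t.2.2, neg_mul]

variable [IsProbabilityMeasure P] {Φ : Linfty P → ℝ}

lemma IsSpectral.mono (hΦ : IsSpectral P Φ) {X Y : Linfty P} (hXY : IntegratedQuantileLE P Y X) :
    Φ X ≤ Φ Y := by
  obtain ⟨c, h, hc, hh, h0, hi, -, hf⟩ := hΦ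
  rw [hf X, hf Y, neg_le_neg_iff]
  exact add_le_add (mul_le_mul_of_nonneg_left hXY.upperQuantile_zero_le hc)
    (hXY.setIntegral_mul_le hh h0 hi)

lemma IsSpectral.add_const (hΦ : IsSpectral P Φ) (X : Linfty P) (m : ℝ) :
    Φ (X + Lp.const ⊤ P m) = Φ X - m := by
  obtain ⟨c, h, hc, hh, h0, hi, h1, hf⟩ := hΦ
  have e : ∫ t in Ioo 0 1, upperQuantile P (X + Lp.const ⊤ P m) t * h t
      = ∫ t in Ioo 0 1, (upperQuantile P X t * h t + m * h t) := by
    refine setIntegral_congr_fun measurableSet_Ioo fun t ht => ?_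
    rw [upperQuantile_add_const X m (Ioo_subset_Ico_self ht), add_mul]
  rw [hf, hf, e, upperQuantile_add_const X m ⟨le_rfl, zero_lt_one⟩,
    integral_add (integrableOn_upperQuantile_mul X hi) (hi.const_mul m), integral_const_mul]
  linear_combination -m * h1

lemma IsSpectral.smul (hΦ : IsSpectral P Φ) (X : Linfty P) {a : ℝ} (ha : 0 ≤ a) :
    Φ (a • X) = a * Φ X := by
  obtain ⟨c, h, hc, hh, h0, hi, h1, hf⟩ := hΦ
  have e : ∫ t in Ioo 0 1, upperQuantile P (a • X) t * h t
      = ∫ t in Ioo 0 1, a * (upperQuantile P X t * h t) := by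
    refine setIntegral_congr_fun measurableSet_Ioo fun t ht => ?_
    rw [upperQuantile_smul X ha (Ioo_subset_Ico_self ht), mul_assoc]
  rw [hf, hf, e, upperQuantile_smul X ha ⟨le_rfl, zero_lt_one⟩, integral_const_mul]
  ring

end Spectral

/-! ### Concave distribution functions -/

namespace ConcaveDistFun

/-- The extension of a concave distribution function to the real line. -/
def extend (ψ : ConcaveDistFun) : ℝ → ℝ := IccExtend (zero_le_one (α := ℝ)) ψ.toFun

lemma extend_coe (ψ : ConcaveDistFun) (t : I) : ψ.extend t = ψ.toFun t :=
  IccExtend_of_mem _ _ t.2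

lemma extend_zero (ψ : ConcaveDistFun) : ψ.extend 0 = ψ.toFun 0 := ψ.extend_coe 0

lemma extend_one (ψ : ConcaveDistFun) : ψ.extend 1 = 1 := (ψ.extend_coe 1).trans ψ.map_one

lemma monotone_extend (ψ : ConcaveDistFun) : Monotone ψ.extend := ψ.mono'.IccExtend _

/-- Concavity gives continuity inside only. At 0 it is right continuity; at 1 the function is
squeezed between the chord and its value there. -/
lemma continuousOn_extend (ψ : ConcaveDistFun) : ContinuousOn ψ.extend (Icc 0 1) := by
  intro x hx
  rcases hx.1.eq_or_lt with rfl | h0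
  · have h : ContinuousAt ψ.toFun 0 := by
      have := ψ.right_continuous' 0
      rwa [show Ici (0 : I) = univ from eq_univ_of_forall fun t => t.2.1,
        continuousWithinAt_univ] at this
    refine ContinuousAt.continuousWithinAt ?_
    have hp : projIcc (0 : ℝ) 1 zero_le_one 0 = 0 := projIcc_left _
    exact ContinuousAt.comp (f := projIcc (0 : ℝ) 1 zero_le_one) (by rwa [hp])
      continuous_projIcc.continuousAt
  rcases hx.2.eq_or_lt with rfl | h1
  · have hlow : Filter.Tendsto (fun x : ℝ => (1 - x) * ψ.extend 0 + x * ψ.extend 1)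
        (nhdsWithin 1 (Icc 0 1)) (nhds (ψ.extend 1)) := by
      have : Continuous fun x : ℝ => (1 - x) * ψ.extend 0 + x * ψ.extend 1 := by fun_prop
      have h := this.continuousAt (x := 1)
      rw [ContinuousAt] at h
      simp only [sub_self, zero_mul, zero_add, one_mul] at h
      exact h.mono_left nhdsWithin_le_nhds
    refine tendsto_of_tendsto_of_tendsto_of_le_of_le' hlow tendsto_const_nhds ?_ ?_
    · filter_upwards [self_mem_nhdsWithin] with y hy
      have := ψ.concave.2 (left_mem_Icc.2 zero_le_one) (right_mem_Icc.2 zero_le_one)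
        (sub_nonneg.2 hy.2) hy.1 (sub_add_cancel 1 y)
      simpa [extend] using this
    · filter_upwards [self_mem_nhdsWithin] with y hy
      exact ψ.monotone_extend hy.2
  · have := ψ.concave.continuousOn_interior x (by rw [interior_Icc]; exact ⟨h0, h1⟩)
    rw [interior_Icc] at this
    exact (this.continuousAt (Ioo_mem_nhds h0 h1)).continuousWithinAt

/-- The right derivative of a concave distribution function. -/
def density (ψ : ConcaveDistFun) (t : ℝ) : ℝ := -derivWithin (-ψ.extend) (Ioi t) t

lemma convexOn_neg_extend (ψ : ConcaveDistFun) : ConvexOn ℝ (Icc 0 1) (-ψ.extend) :=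
  ψ.concave.neg

lemma hasDerivWithinAt_extend (ψ : ConcaveDistFun) {t : ℝ} (ht : t ∈ Ioo (0 : ℝ) 1) :
    HasDerivWithinAt ψ.extend (ψ.density t) (Ioi t) t := by
  have := (ψ.convexOn_neg_extend.hasDerivWithinAt_rightDeriv_of_mem_interior
    (x := t) (by rwa [interior_Icc])).neg
  rwa [neg_neg] at this

lemma antitoneOn_density (ψ : ConcaveDistFun) : AntitoneOn ψ.density (Ioo 0 1) := by
  have := ψ.convexOn_neg_extend.monotoneOn_rightDeriv
  rw [interior_Icc] at this
  exact fun s hs t ht hst => neg_le_neg (this hs ht hst)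

lemma density_nonneg (ψ : ConcaveDistFun) {t : ℝ} (ht : t ∈ Ioo (0 : ℝ) 1) :
    0 ≤ ψ.density t := by
  have h := ψ.hasDerivWithinAt_extend ht
  rw [hasDerivWithinAt_iff_tendsto_slope' (by simp)] at h
  refine ge_of_tendsto h ?_
  filter_upwards [self_mem_nhdsWithin] with y hy
  rw [slope_def_field]
  exact div_nonneg (sub_nonneg.2 (ψ.monotone_extend (le_of_lt hy))) (sub_nonneg.2 (le_of_lt hy))

lemma integrableOn_density (ψ : ConcaveDistFun) : IntegrableOn ψ.density (Ioo 0 1) :=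
  (intervalIntegral.integrableOn_deriv_right_of_nonneg ψ.continuousOn_extend
    (fun _ => ψ.hasDerivWithinAt_extend) fun _ => ψ.density_nonneg).mono_set Ioo_subset_Ioc_self

lemma setIntegral_density (ψ : ConcaveDistFun) {a : ℝ} (ha : a ∈ Icc (0 : ℝ) 1) :
    ∫ t in Ioo 0 a, ψ.density t = ψ.extend a - ψ.toFun 0 := by
  rw [← ψ.extend_zero, ← integral_Ioc_eq_integral_Ioo, ← intervalIntegral.integral_of_le ha.1]
  refine intervalIntegral.integral_eq_sub_of_hasDeriv_right_of_le ha.1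
    (ψ.continuousOn_extend.mono (Icc_subset_Icc_right ha.2))
    (fun t ht => ψ.hasDerivWithinAt_extend ⟨ht.1, ht.2.trans_le ha.2⟩) ?_
  rw [intervalIntegrable_iff_integrableOn_Ioo_of_le ha.1]
  exact ψ.integrableOn_density.mono_set (Ioo_subset_Ioo_right ha.2)

lemma map_measure (ψ : ConcaveDistFun) :
    ψ.measure.map ((↑) : I → ℝ) = ENNReal.ofReal (ψ.toFun 0) • Measure.dirac 0
      + (volume.restrict (Ioo 0 1)).withDensity fun t => ENNReal.ofReal (ψ.density t) := by
  have : IsProbabilityMeasure (ψ.measure.map ((↑) : I → ℝ)) :=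
    Measure.isProbabilityMeasure_map measurable_subtype_coe.aemeasurable
  refine Measure.ext_of_Iic _ _ fun a => ?_
  rw [Measure.map_apply measurable_subtype_coe measurableSet_Iic, Measure.add_apply,
    Measure.smul_apply, Measure.dirac_apply' _ measurableSet_Iic,
    withDensity_apply _ measurableSet_Iic, Measure.restrict_restrict measurableSet_Iic]
  rcases lt_or_ge a 0 with h | h
  · have h1 : ((↑) : I → ℝ) ⁻¹' Iic a = ∅ :=
      eq_empty_of_forall_notMem fun t ht => absurd (t.2.1.trans ht) (not_le.2 h)
    have h2 : Iic a ∩ Ioo (0 : ℝ) 1 = ∅ :=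
      eq_empty_of_forall_notMem fun t ht => absurd (ht.2.1.le.trans ht.1) (not_le.2 h)
    rw [h1, h2]
    simp [h]
  · have hb : min a 1 ∈ Icc (0 : ℝ) 1 := ⟨le_min h zero_le_one, min_le_right _ _⟩
    set b : I := ⟨min a 1, hb⟩
    have h1 : ((↑) : I → ℝ) ⁻¹' Iic a = Iic b := by
      ext t
      exact ⟨fun ht => show (t : ℝ) ≤ min a 1 from le_min ht t.2.2,
        fun ht => (show (t : ℝ) ≤ min a 1 from ht).trans (min_le_left _ _)⟩
    have h2 : (Iic a ∩ Ioo 0 1 : Set ℝ) =ᵐ[volume] Ioo 0 (min a 1) := by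
      have e1 : (Iic a ∩ Ioo 0 1 : Set ℝ) =ᵐ[volume] (Iio a ∩ Ioo 0 1 : Set ℝ) :=
        Iio_ae_eq_Iic.symm.inter (Filter.EventuallyEq.refl _ _)
      have e2 : (Iio a ∩ Ioo 0 1 : Set ℝ) = Ioo 0 (min a 1) := by
        ext t
        simp only [mem_inter_iff, mem_Iio, mem_Ioo, lt_min_iff]
        tauto
      rwa [e2] at e1
    have hnn : 0 ≤ᵐ[volume.restrict (Ioo 0 (min a 1))] ψ.density := by
      filter_upwards [ae_restrict_mem measurableSet_Ioo] with t ht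
      exact ψ.density_nonneg ⟨ht.1, ht.2.trans_le hb.2⟩
    rw [h1, DistFun.measure_Iic, Measure.restrict_congr_set h2,
      ← ofReal_integral_eq_lintegral_ofReal
        (ψ.integrableOn_density.mono_set (Ioo_subset_Ioo_right hb.2)) hnn,
      ψ.setIntegral_density hb, indicator_of_mem (show (0 : ℝ) ∈ Iic a from h), Pi.one_apply,
      smul_eq_mul, mul_one, ← ENNReal.ofReal_add ψ.zero_nonneg, add_sub_cancel]
    · exact congrArg _ (ψ.extend_coe b).symm
    · rw [← ψ.extend_zero]
      exact sub_nonneg.2 (ψ.monotone_extend hb.1)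

/-- The density is the right derivative of ψ itself, so no preimage under `J` is needed. -/
lemma isSpectral {Ω : Type*} [MeasurableSpace Ω] {P : Measure Ω} [IsProbabilityMeasure P]
    (ψ : ConcaveDistFun) : IsSpectral P fun X : Linfty P => ∫ t : I, VaR P X t ∂ψ.measure := by
  refine ⟨ψ.toFun 0, ψ.density, ψ.zero_nonneg, ψ.antitoneOn_density, fun _ => ψ.density_nonneg,
    ψ.integrableOn_density, ?_, fun X => ?_⟩
  · rw [ψ.setIntegral_density (right_mem_Icc.2 zero_le_one), ψ.extend_one, add_sub_cancel]
  have hm : AEMeasurable (fun t => ENNReal.ofReal (ψ.density t)) (volume.restrict (Ioo 0 1)) :=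
    (aemeasurable_of_antitoneOn ψ.antitoneOn_density).ennreal_ofReal
  have hi : Integrable (VaR P X) (ψ.measure.map ((↑) : I → ℝ)) :=
    unitInterval.measurableEmbedding_coe.integrable_map_iff.2 (integrable_VaR X ψ.measure)
  beta_reduce
  rw [← unitInterval.measurableEmbedding_coe.integral_map (g := VaR P X)]
  rw [map_measure] at hi ⊢
  rw [integral_add_measure (hi.mono_measure (Measure.le_add_right le_rfl))
      (hi.mono_measure (Measure.le_add_left le_rfl)), integral_smul_measure, integral_dirac,
    integral_withDensity_eq_integral_toReal_smul₀ hm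
      (Filter.Eventually.of_forall fun _ => ENNReal.ofReal_lt_top),
    ENNReal.toReal_ofReal ψ.zero_nonneg, VaR_of_lt_one X zero_lt_one, neg_add, ← integral_neg,
    smul_eq_mul, mul_neg]
  congr 1
  refine setIntegral_congr_fun measurableSet_Ioo fun t ht => ?_
  rw [ENNReal.toReal_ofReal (ψ.density_nonneg ht), VaR_of_lt_one X ht.2, smul_eq_mul]
  ring

end ConcaveDistFun

/-! ### Distribution functions and probability measures on `[0, 1]` -/

namespace DistFun

/-- The probability measure with distribution function `w`. -/
def toProbabilityMeasure (w : DistFun) : ProbabilityMeasure I := ⟨w.measure, inferInstance⟩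

lemma isInducing_toProbabilityMeasure : Topology.IsInducing toProbabilityMeasure := ⟨rfl⟩

instance (μ : Measure I) [IsProbabilityMeasure μ] :
    IsProbabilityMeasure (μ.map ((↑) : I → ℝ)) :=
  Measure.isProbabilityMeasure_map measurable_subtype_coe.aemeasurable

/-- The distribution function of a probability measure on `[0, 1]`. -/
def ofMeasure (μ : Measure I) [IsProbabilityMeasure μ] : DistFun where
  toFun t := ProbabilityTheory.cdf (μ.map ((↑) : I → ℝ)) t
  mono' _ _ hst := ProbabilityTheory.monotone_cdf _ hst
  right_continuous' t := by
    have h := (ProbabilityTheory.cdf (μ.map ((↑) : I → ℝ))).right_continuous (t : ℝ)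
    exact ContinuousWithinAt.comp (g := ProbabilityTheory.cdf (μ.map ((↑) : I → ℝ))) h
      continuous_subtype_val.continuousWithinAt fun s hs => hs
  zero_nonneg := ProbabilityTheory.cdf_nonneg _ _
  map_one := by
    rw [ProbabilityTheory.cdf_eq_real, Measure.real,
      Measure.map_apply measurable_subtype_coe measurableSet_Iic,
      show ((↑) : I → ℝ) ⁻¹' Iic ((1 : I) : ℝ) = univ from eq_univ_of_forall fun t => t.2.2]
    simp

lemma measure_ofMeasure (μ : Measure I) [IsProbabilityMeasure μ] : (ofMeasure μ).measure = μ := by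
  refine Measure.ext_of_Iic _ _ fun t => ?_
  rw [measure_Iic]
  change ENNReal.ofReal (ProbabilityTheory.cdf (μ.map ((↑) : I → ℝ)) t) = _
  rw [ProbabilityTheory.ofReal_cdf, Measure.map_apply measurable_subtype_coe measurableSet_Iic]
  rfl

lemma surjective_toProbabilityMeasure : Function.Surjective toProbabilityMeasure := fun μ =>
  ⟨ofMeasure μ, Subtype.ext (measure_ofMeasure (μ : Measure I))⟩

instance : CompactSpace DistFun := by
  rw [← isCompact_univ_iff, isInducing_toProbabilityMeasure.isCompact_iff, image_univ,
    surjective_toProbabilityMeasure.range_eq]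
  exact isCompact_univ

lemma continuous_integral {f : I → ℝ} (hf : Continuous f) :
    Continuous fun w : DistFun => ∫ s, f s ∂w.measure :=
  (ProbabilityMeasure.continuous_integral_boundedContinuousFunction
    (BoundedContinuousFunction.mkOfCompact ⟨f, hf⟩)).comp
      isInducing_toProbabilityMeasure.continuous

end DistFun

lemma continuous_J : Continuous J := continuous_coinduced_rng

lemma lintegral_min_div (w : DistFun) (t : I) :
    ENNReal.ofReal (mixFun w t)
      = w.measure {0} + ∫⁻ s in Ioc (0 : I) 1, ENNReal.ofReal (min ((t : ℝ) / s) 1) ∂w.measure := by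
  have h0 : ({0} : Set I) = Iic 0 := by
    ext s
    exact ⟨fun h => h.le, fun h => le_antisymm h s.2.1⟩
  have hnn : 0 ≤ᵐ[w.measure.restrict (Ioc 0 1)] fun s : I => min ((t : ℝ) / s) 1 :=
    Filter.Eventually.of_forall fun s => le_min (div_nonneg t.2.1 s.2.1) zero_le_one
  rw [mixFun, ENNReal.ofReal_add w.zero_nonneg (integral_nonneg_of_ae hnn), h0,
    DistFun.measure_Iic, ofReal_integral_eq_lintegral_ofReal (mixFun_integrable w t _) hnn]

/-- The measure of `J w` is the distribution of `s * u` for `s` with distribution `w` and an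
independent uniform `u`. -/
lemma J_measure (w : DistFun) :
    (J w).measure = (w.measure.prod volume).map fun p : I × I => p.1 * p.2 := by
  have hm : Measurable fun p : I × I => p.1 * p.2 := continuous_mul.measurable
  have hlevel (t s : I) (hs : 0 < s) :
      volume {u : I | s * u ≤ t} = ENNReal.ofReal (min ((t : ℝ) / s) 1) := by
    have hs0 : (0 : ℝ) < s := hs
    have hb : min ((t : ℝ) / s) 1 ∈ Icc (0 : ℝ) 1 :=
      ⟨le_min (div_nonneg t.2.1 hs0.le) zero_le_one, min_le_right _ _⟩
    have : {u : I | s * u ≤ t} = Iic ⟨min ((t : ℝ) / s) 1, hb⟩ := by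
      ext u
      change (s : ℝ) * u ≤ t ↔ (u : ℝ) ≤ min ((t : ℝ) / s) 1
      rw [le_min_iff, le_div_iff₀ hs0, mul_comm (u : ℝ)]
      exact ⟨fun h => ⟨h, u.2.2⟩, And.left⟩
    rw [this, unitInterval.volume_Iic]
  refine Measure.ext_of_Iic _ _ fun t => ?_
  rw [DistFun.measure_Iic, Measure.map_apply hm measurableSet_Iic,
    Measure.prod_apply (hm measurableSet_Iic)]
  change ENNReal.ofReal (mixFun w t) = ∫⁻ s, volume {u : I | s * u ≤ t} ∂w.measure
  -- The point s = 0 is split off: there s * u ≤ t always holds, whereas `min (t / 0) 1 = 0` by the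
  -- division convention.
  have hu : (univ : Set I) = {0} ∪ Ioc 0 1 := by
    ext s
    refine ⟨fun _ => ?_, fun _ => mem_univ _⟩
    rcases (show (0 : I) ≤ s from s.2.1).eq_or_lt with h | h
    · exact Or.inl h.symm
    · exact Or.inr ⟨h, s.2.2⟩
  rw [lintegral_min_div, ← setLIntegral_univ fun s : I => volume {u : I | s * u ≤ t}, hu,
    lintegral_union measurableSet_Ioc (by simp), lintegral_singleton]
  congr 1
  · have : {u : I | 0 * u ≤ t} = univ := eq_univ_of_forall fun u => by
      rw [mem_ofPred_eq, zero_mul]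
      exact t.2.1
    rw [this, measure_univ, one_mul]
  · exact setLIntegral_congr_fun measurableSet_Ioc fun s hs => (hlevel t s hs.1).symm

/-- Writing w(0) as the mass of {0} expresses the function through the measure alone, which makes it
visibly affine in that measure. -/
lemma mixFun_eq (w : DistFun) (t : I) :
    mixFun w t = w.measure.real {0} + ∫ s in Ioc (0 : I) 1, min ((t : ℝ) / s) 1 ∂w.measure := by
  have h0 : ({0} : Set I) = Iic 0 := by
    ext s
    exact ⟨fun h => h.le, fun h => le_antisymm h s.2.1⟩
  rw [mixFun, Measure.real, h0, DistFun.measure_Iic, ENNReal.toReal_ofReal w.zero_nonneg]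

lemma mixFun_convexCombination {w w₁ w₂ : DistFun} {a b : ℝ} (ha : 0 ≤ a) (hb : 0 ≤ b)
    (h : w.measure = ENNReal.ofReal a • w₁.measure + ENNReal.ofReal b • w₂.measure) :
    mixFun w = a • mixFun w₁ + b • mixFun w₂ := by
  ext t
  have h0 : w.measure.real {0} = a * w₁.measure.real {0} + b * w₂.measure.real {0} := by
    have := w₁.measure.smul_finite (ENNReal.ofReal_ne_top (r := a))
    have := w₂.measure.smul_finite (ENNReal.ofReal_ne_top (r := b))
    rw [h, measureReal_add_apply, measureReal_ennreal_smul_apply, measureReal_ennreal_smul_apply,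
      ENNReal.toReal_ofReal ha, ENNReal.toReal_ofReal hb]
  have h1 : ∫ s in Ioc (0 : I) 1, min ((t : ℝ) / s) 1 ∂w.measure
      = a * ∫ s in Ioc (0 : I) 1, min ((t : ℝ) / s) 1 ∂w₁.measure
        + b * ∫ s in Ioc (0 : I) 1, min ((t : ℝ) / s) 1 ∂w₂.measure := by
    rw [h, Measure.restrict_add, Measure.restrict_smul, Measure.restrict_smul,
      integral_add_measure ((mixFun_integrable w₁ t _).smul_measure ENNReal.ofReal_ne_top)
        ((mixFun_integrable w₂ t _).smul_measure ENNReal.ofReal_ne_top),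
      integral_smul_measure, integral_smul_measure,
      ENNReal.toReal_ofReal ha, ENNReal.toReal_ofReal hb, smul_eq_mul, smul_eq_mul]
  rw [mixFun_eq, h0, h1, Pi.add_apply, Pi.smul_apply, Pi.smul_apply, mixFun_eq, mixFun_eq,
    smul_eq_mul, smul_eq_mul]
  ring

/-! ### The average value at risk -/

section AVaR

variable {Ω : Type*} [MeasurableSpace Ω] {P : Measure Ω}

/-- The average value at risk at level `s ∈ [0, 1]`: the mean of the value at risk on `[0, s]`. -/
def AVaR (P : Measure Ω) (X : Linfty P) (s : I) : ℝ := ∫ u : I, VaR P X (s * u : I)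

lemma AVaR_zero (X : Linfty P) : AVaR P X 0 = VaR P X 0 := by
  simp [AVaR]

lemma AVaR_of_pos (X : Linfty P) {s : I} (hs : 0 < s) :
    AVaR P X s = -((s : ℝ)⁻¹ * ∫ t in Ioo (0 : ℝ) s, upperQuantile P X t) := by
  have hs0 : (0 : ℝ) < s := hs
  have h1 : AVaR P X s = ∫ u in Icc (0 : ℝ) 1, VaR P X (s * u) :=
    integral_subtype_comap measurableSet_Icc fun u : ℝ => VaR P X (s * u)
  rw [h1, integral_Icc_eq_integral_Ioc, ← intervalIntegral.integral_of_le zero_le_one,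
    intervalIntegral.integral_comp_mul_left _ hs0.ne', mul_zero, mul_one,
    intervalIntegral.integral_of_le hs0.le, integral_Ioc_eq_integral_Ioo, smul_eq_mul, ← mul_neg,
    ← integral_neg]
  congr 1
  refine setIntegral_congr_fun measurableSet_Ioo fun t ht => ?_
  exact VaR_of_lt_one X (ht.2.trans_le s.2.2)

lemma integratedQuantileLE_iff (X Y : Linfty P) :
    IntegratedQuantileLE P Y X ↔ ∀ s : I, 0 < s → AVaR P X s ≤ AVaR P Y s := by
  have key (s : I) (hs : 0 < s) : AVaR P X s ≤ AVaR P Y s ↔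
      ∫ t in Ioo (0 : ℝ) s, upperQuantile P Y t ≤ ∫ t in Ioo (0 : ℝ) s, upperQuantile P X t := by
    rw [AVaR_of_pos X hs, AVaR_of_pos Y hs, neg_le_neg_iff,
      mul_le_mul_iff_right₀ (inv_pos.2 (show (0 : ℝ) < s from hs))]
  exact ⟨fun h s hs => (key s hs).2 (h s ⟨hs, s.2.2⟩),
    fun h s hs => (key ⟨s, hs.1.le, hs.2⟩ hs.1).1 (h _ hs.1)⟩

variable [IsProbabilityMeasure P]

/-- Fubini for the product s * u in `J_measure`: integrating out u leaves AVaR. Unlike VaR, this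
integrand is continuous in s, hence suited to the weak topology. -/
lemma integral_VaR_J (X : Linfty P) (w : DistFun) :
    ∫ t : I, VaR P X t ∂(J w).measure = ∫ s, AVaR P X s ∂w.measure := by
  have hm : Measurable fun p : I × I => p.1 * p.2 := continuous_mul.measurable
  rw [J_measure, integral_map hm.aemeasurable (measurable_VaR X).aestronglyMeasurable]
  refine integral_prod _ ?_
  obtain ⟨M, -, hM⟩ := exists_ae_bound X
  exact Integrable.of_bound ((measurable_VaR X).comp hm).aestronglyMeasurable M
    (Filter.Eventually.of_forall fun p => abs_VaR_le hM _)

lemma integrable_VaR_mul (X : Linfty P) (s : I) :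
    Integrable (fun u : I => VaR P X (s * u : I)) volume := by
  obtain ⟨M, -, hM⟩ := exists_ae_bound X
  exact Integrable.of_bound
    ((measurable_VaR X).comp (measurable_const_mul s)).aestronglyMeasurable M
    (Filter.Eventually.of_forall fun u => abs_VaR_le hM _)

/-- AVaR_s ≤ VaR_0 as VaR is decreasing in the level; conversely, q is right continuous at 0. -/
lemma continuousAt_AVaR_zero (X : Linfty P) : ContinuousAt (AVaR P X) 0 := by
  rw [Metric.continuousAt_iff]
  intro ε hε
  obtain ⟨δ, hδ, x, hx, hq⟩ := exists_upperQuantile_le X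
    (show upperQuantile P X 0 < upperQuantile P X 0 + ε by linarith)
  refine ⟨δ, hδ.1, fun {s} hs => ?_⟩
  have hsδ : (s : ℝ) < δ := by
    rw [Subtype.dist_eq, Real.dist_eq] at hs
    simpa [abs_of_nonneg s.2.1] using hs
  have hle (u : I) : ((s * u : I) : ℝ) ≤ s := mul_le_of_le_one_right s.2.1 u.2.2
  have hu : AVaR P X s ≤ VaR P X 0 := by
    have h := integral_mono (integrable_VaR_mul X s) (integrable_const (VaR P X 0))
      fun u => antitone_VaR X (show (0 : I) ≤ s * u from (s * u).2.1)
    simpa [AVaR] using h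
  have hl : -x ≤ AVaR P X s := by
    have h := integral_mono (integrable_const (-x)) (integrable_VaR_mul X s) fun u => by
      have h1 : ((s * u : I) : ℝ) < δ := (hle u).trans_lt hsδ
      beta_reduce
      rw [VaR_of_lt_one X (h1.trans_le hδ.2), neg_le_neg_iff]
      exact hq _ ⟨(s * u).2.1, h1⟩
    simpa [AVaR] using h
  rw [AVaR_zero, Real.dist_eq, abs_lt]
  rw [VaR_of_lt_one X zero_lt_one] at hu ⊢
  constructor <;> linarith

lemma continuous_AVaR (X : Linfty P) : Continuous (AVaR P X) := by
  rw [continuous_iff_continuousAt]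
  intro s
  rcases (show (0 : I) ≤ s from s.2.1).eq_or_lt with rfl | hs
  · exact continuousAt_AVaR_zero X
  have hs0 : (0 : ℝ) < s := hs
  have hc : Continuous fun r : I => ∫ t in Ioo (0 : ℝ) r, upperQuantile P X t := by
    have h := intervalIntegral.continuousOn_primitive_interval (a := (0 : ℝ)) (b := 1)
      (μ := volume) (f := upperQuantile P X) (by
        rw [uIcc_of_le zero_le_one, integrableOn_Icc_iff_integrableOn_Ioo]
        exact integrableOn_upperQuantile X)
    rw [uIcc_of_le zero_le_one, continuousOn_iff_continuous_domRestrict] at h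
    refine h.congr fun r => ?_
    rw [domRestrict_apply, intervalIntegral.integral_of_le r.2.1, integral_Ioc_eq_integral_Ioo]
  have hat : ContinuousAt
      (fun r : I => -((r : ℝ)⁻¹ * ∫ t in Ioo (0 : ℝ) r, upperQuantile P X t)) s :=
    ((continuous_subtype_val.continuousAt.inv₀ hs0.ne').mul hc.continuousAt).neg
  refine hat.congr ?_
  filter_upwards [lt_mem_nhds hs] with r hr
  exact (AVaR_of_pos X hr).symm

lemma AVaR_eq_integral_J_dirac (X : Linfty P) (s : I) :
    AVaR P X s = ∫ t : I, VaR P X t ∂(J (DistFun.ofMeasure (Measure.dirac s))).measure := by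
  rw [integral_VaR_J, DistFun.measure_ofMeasure, integral_dirac]

lemma isSpectral_AVaR (s : I) : IsSpectral P fun X : Linfty P => AVaR P X s := by
  simp only [AVaR_eq_integral_J_dirac]
  exact ConcaveDistFun.isSpectral _

end AVaR

/-! ### Min-max representations -/

section MinMax

/-- What `IsMinMax` and `IsMinSup` have in common, and all that the converse directions need. -/
lemma IsMinMax.le_and_exists {Λ S : Type*} {K : Λ → Set S} {F : Λ → S → EReal} {r : ℝ}
    (h : IsMinMax K F r) : (∀ l b, (∀ s ∈ K l, F l s ≤ b) → (r : EReal) ≤ b) ∧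
      ∃ l, ∀ s ∈ K l, F l s ≤ r := by
  obtain ⟨v, hv, ⟨l, hl⟩, hr⟩ := h
  refine ⟨fun l b hb => ?_, l, fun s hs => hl ▸ (hv l).2 (mem_image_of_mem _ hs)⟩
  obtain ⟨s, hs, hsv⟩ := (hv l).1
  exact (hr (mem_range_self l)).trans (hsv ▸ hb s hs)

lemma IsMinSup.le_and_exists {Λ S : Type*} {F : Λ → S → EReal} {r : ℝ} (h : IsMinSup F r) :
    (∀ l b, (∀ s ∈ (univ : Set S), F l s ≤ b) → (r : EReal) ≤ b) ∧
      ∃ l, ∀ s ∈ (univ : Set S), F l s ≤ r := by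
  obtain ⟨⟨l, hl⟩, hr⟩ := h
  exact ⟨fun l b hb => (hr (mem_range_self l)).trans (iSup_le fun s => hb s (mem_univ s)),
    l, fun s _ => hl ▸ le_iSup (F l) s⟩

lemma isMinMax_of {Λ S : Type*} {K : Λ → Set S} {F : Λ → S → EReal} {r : ℝ}
    (hmax : ∀ l, ∃ s ∈ K l, (∀ s' ∈ K l, F l s' ≤ F l s) ∧ (r : EReal) ≤ F l s)
    (hmin : ∃ l, ∀ s ∈ K l, F l s ≤ r) : IsMinMax K F r := by
  choose s hs hle hr using hmax
  refine ⟨fun l => F l (s l), fun l => ⟨mem_image_of_mem _ (hs l), ?_⟩, ?_, ?_⟩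
  · rintro _ ⟨s', hs', rfl⟩
    exact hle l s' hs'
  · obtain ⟨l, hl⟩ := hmin
    exact ⟨l, le_antisymm (hl _ (hs l)) (hr l)⟩
  · rintro _ ⟨l, rfl⟩
    exact hr l

/-- Use for X the index that is optimal for Y. A single inequality with a constant c covers both
dominance and translation. -/
lemma le_add_of_le_and_exists {L Λ S : Type*} {ρ : L → ℝ} {K : Λ → Set S} {Φ : S → L → ℝ}
    {α : Λ → S → EReal}
    (h : ∀ X, (∀ l b, (∀ s ∈ K l, (Φ s X : EReal) - α l s ≤ b) → (ρ X : EReal) ≤ b) ∧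
      ∃ l, ∀ s ∈ K l, (Φ s X : EReal) - α l s ≤ ρ X)
    {X Y : L} {c : ℝ} (hXY : ∀ s, Φ s X ≤ Φ s Y + c) : ρ X ≤ ρ Y + c := by
  obtain ⟨l, hl⟩ := (h Y).2
  have := (h X).1 l ((ρ Y + c : ℝ) : EReal) fun s hs => by
    calc (Φ s X : EReal) - α l s ≤ ((Φ s Y + c : ℝ) : EReal) - α l s :=
          EReal.sub_le_sub (EReal.coe_le_coe_iff.2 (hXY s)) le_rfl
      _ = ((Φ s Y : EReal) - α l s) + c := by
          rw [EReal.coe_add, sub_eq_add_neg, sub_eq_add_neg, add_right_comm]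
      _ ≤ (ρ Y : EReal) + c := add_le_add (hl s hs) le_rfl
      _ = _ := (EReal.coe_add _ _).symm
  exact EReal.coe_le_coe_iff.1 this

end MinMax

/-! ### Uniform densities on initial intervals -/

/-- The density is 1/s on (0, s). Level 0 is excluded because AVaR_0 corresponds to an atom. -/
lemma exists_density_eq_AVaR {Ω : Type*} [MeasurableSpace Ω]
    (P : Measure Ω) {s : I} (hs : 0 < s) :
    ∃ g ∈ decreasingDensities, ∀ X : Linfty P,
      ∫ t : Ioo (0 : ℝ) 1, VaR P X t * g t ∂lebesgue = AVaR P X s := by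
  have hs0 : (0 : ℝ) < s := hs
  have hsub : Iio (s : ℝ) ∩ Ioo 0 1 = Ioo 0 (s : ℝ) := by
    ext t
    exact ⟨fun h => ⟨h.2.1, h.1⟩, fun h => ⟨h.2, h.1, h.2.trans_le s.2.2⟩⟩
  have hint (f : ℝ → ℝ) : ∫ t : Ioo (0 : ℝ) 1,
      f t * (Iio (s : ℝ)).indicator (fun _ => (s : ℝ)⁻¹) t ∂lebesgue
        = (s : ℝ)⁻¹ * ∫ t in Ioo (0 : ℝ) s, f t := by
    rw [lebesgue, integral_subtype_comap measurableSet_Ioo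
      fun t => f t * (Iio (s : ℝ)).indicator (fun _ => (s : ℝ)⁻¹) t]
    simp only [← indicator_mul_right]
    rw [integral_indicator measurableSet_Iio, Measure.restrict_restrict measurableSet_Iio, hsub,
      integral_mul_const, mul_comm]
  refine ⟨fun t => (Iio (s : ℝ)).indicator (fun _ => (s : ℝ)⁻¹) t,
    ⟨(measurable_const.indicator measurableSet_Iio).comp measurable_subtype_coe,
      fun t => indicator_nonneg (fun _ _ => (inv_pos.2 hs0).le) _, ?_, fun t u htu => ?_⟩,
    fun X => ?_⟩
  · have := hint fun _ => 1
    simp only [one_mul] at this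
    rw [this]
    simp [Real.volume_real_Ioo_of_le hs0.le, hs0.ne']
  · have htu' : (t : ℝ) ≤ u := htu
    beta_reduce
    by_cases h : (u : ℝ) ∈ Iio (s : ℝ)
    · rw [indicator_of_mem h, indicator_of_mem (show (t : ℝ) ∈ Iio (s : ℝ) from htu'.trans_lt h)]
    · rw [indicator_of_notMem h]
      exact indicator_nonneg (fun _ _ => (inv_pos.2 hs0).le) _
  · rw [hint (VaR P X), AVaR_of_pos X hs, ← mul_neg, ← integral_neg]
    congr 1
    exact setIntegral_congr_fun measurableSet_Ioo fun t ht =>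
      VaR_of_lt_one X (ht.2.trans_le s.2.2)

instance : Nonempty decreasingDensities := by
  obtain ⟨g, hg, -⟩ := exists_density_eq_AVaR (Measure.dirac ()) (s := 1) one_pos
  exact ⟨g, hg⟩

/-! ### From representations to risk measures -/

section Representation

variable {Ω : Type*} [MeasurableSpace Ω] {P : Measure Ω} [IsProbabilityMeasure P]

lemma integrable_comp {f : ℝ → ℝ} (hf : Monotone f) (X : Linfty P) :
    Integrable (fun ω => f (X ω)) P := by
  obtain ⟨M, -, hM⟩ := exists_ae_bound X
  refine Integrable.of_bound (hf.measurable.comp (measurable_coe X)).aestronglyMeasurable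
    (max |f M| |f (-M)|) ?_
  filter_upwards [hM] with ω hω
  have hb := abs_le.1 hω
  exact (abs_le_max_abs_abs (hf hb.1) (hf hb.2)).trans (max_comm _ _).le

lemma ssd_of_le {X Y : Linfty P} (h : X ≤ Y) : SSD P Y X := fun _ hf _ =>
  integral_mono_ae (integrable_comp hf X) (integrable_comp hf Y)
    (((Lp.coeFn_le X Y).2 h).mono fun _ hω => hf hω)

variable {ρ : Linfty P → ℝ}

lemma isMonetary_and_isSSDConsistent_of_spectral {S : Type*} {Φ : S → Linfty P → ℝ}
    (hΦ : ∀ s, IsSpectral P (Φ s))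
    (h : ∀ (X Y : Linfty P) (c : ℝ), (∀ s, Φ s X ≤ Φ s Y + c) → ρ X ≤ ρ Y + c) :
    IsMonetary P ρ ∧ IsSSDConsistent P ρ := by
  have hssd : IsSSDConsistent P ρ := fun X Y hXY => by
    have := h X Y 0 fun s => by
      rw [add_zero]
      exact (hΦ s).mono hXY.integratedQuantileLE
    rwa [add_zero] at this
  refine ⟨⟨fun X Y hXY => hssd Y X (ssd_of_le hXY), fun X m => le_antisymm ?_ ?_⟩, hssd⟩
  · exact h _ X (-m) fun s => ((hΦ s).add_const X m).le
  · have := h X (X + Lp.const ⊤ P m) m fun s => by rw [(hΦ s).add_const X m, sub_add_cancel]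
    linarith

/-- The hypothesis says that X + r dominates Z, so ρ(X) - r ≤ ρ(Z) ≤ 0. -/
lemma le_of_AVaR_le (hm : IsMonetary P ρ) (hs : IsSSDConsistent P ρ) {X Z : Linfty P} {r : ℝ}
    (hZ : ρ Z ≤ 0) (h : ∀ s : I, 0 < s → AVaR P X s ≤ AVaR P Z s + r) : ρ X ≤ r := by
  have hq : IntegratedQuantileLE P Z (X + Lp.const ⊤ P r) :=
    (integratedQuantileLE_iff _ _).2 fun s hs => by
      have := (isSpectral_AVaR (P := P) s).add_const X r
      beta_reduce at this
      linarith [h s hs]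
  have := hs _ _ hq.ssd
  rw [hm.translation] at this
  linarith

lemma IsSpectral.le_add {Φ : Linfty P → ℝ} (hΦ : IsSpectral P Φ) {X Z : Linfty P} {r : ℝ}
    (h : ∀ s : I, 0 < s → AVaR P X s ≤ AVaR P Z s + r) : Φ X ≤ Φ Z + r := by
  have hq : IntegratedQuantileLE P Z (X + Lp.const ⊤ P r) :=
    (integratedQuantileLE_iff _ _).2 fun s hs => by
      have := (isSpectral_AVaR (P := P) s).add_const X r
      beta_reduce at this
      linarith [h s hs]
  have := hΦ.mono hq
  rw [hΦ.add_const] at this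
  linarith

lemma IsMonetary.map_add_self (hm : IsMonetary P ρ) (X : Linfty P) :
    ρ (X + Lp.const ⊤ P (ρ X)) = 0 := by
  rw [hm.translation, sub_self]

/-! ### Representation by decreasing densities -/

lemma isConvexFunctional_density (Z : Linfty P) :
    IsConvexFunctional (fun g : decreasingDensities => g.1)
      fun g => ((∫ t : Ioo (0 : ℝ) 1, VaR P Z t * g.1 t ∂lebesgue : ℝ) : EReal) := by
  refine ⟨fun g => EReal.coe_ne_bot _, fun x y z a b ha hb hab hz => ?_⟩
  have hi (g : decreasingDensities) : Integrable (fun t : Ioo (0 : ℝ) 1 => VaR P Z t * g.1 t) lebesgue := by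
    obtain ⟨M, -, hM⟩ := exists_ae_bound Z
    have hg : Integrable g.1 lebesgue := by
      by_contra h
      exact zero_ne_one ((integral_undef h).symm.trans g.2.2.2.1)
    refine Integrable.bdd_mul (c := M) hg ?_ (Filter.Eventually.of_forall fun t =>
      abs_VaR_le hM ⟨t, t.2.1.le, t.2.2.le⟩)
    have hm : Measurable fun t : Ioo (0 : ℝ) 1 => (⟨t, t.2.1.le, t.2.2.le⟩ : I) :=
      measurable_subtype_coe.subtype_mk
    exact ((measurable_VaR Z).comp hm).aestronglyMeasurable
  have : ∫ t : Ioo (0 : ℝ) 1, VaR P Z t * z.1 t ∂lebesgue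
      = a * ∫ t : Ioo (0 : ℝ) 1, VaR P Z t * x.1 t ∂lebesgue
        + b * ∫ t : Ioo (0 : ℝ) 1, VaR P Z t * y.1 t ∂lebesgue := by
    rw [← integral_const_mul, ← integral_const_mul,
      ← integral_add ((hi x).const_mul a) ((hi y).const_mul b)]
    refine integral_congr_ae (Filter.Eventually.of_forall fun t => ?_)
    have := congrFun hz t
    simp only [Pi.add_apply, Pi.smul_apply, smul_eq_mul] at this
    beta_reduce
    rw [this]
    ring
  beta_reduce
  rw [this]
  push_cast
  exact le_rfl

/-- The densities representation: the penalty functions are the average values at risk of the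
acceptable positions. -/
lemma exists_isMinSup_density (hm : IsMonetary P ρ) (hs : IsSSDConsistent P ρ) :
    ∃ (Λ : Type v) (α : Λ → decreasingDensities → EReal),
      (∀ l, IsConvexFunctional (fun g : decreasingDensities => g.1) (α l)) ∧
      ∀ X : Linfty P, IsMinSup
        (fun l g => ((∫ t : Ioo (0 : ℝ) 1, VaR P X t * g.1 t ∂lebesgue : ℝ) : EReal) - α l g)
        (ρ X) := by
  -- Indexing by penalties rather than by positions Z keeps the index type in `Type 0` whatever the
  -- universe of Ω, so it lifts to `Type v`.
  refine ⟨ULift.{v} {α : decreasingDensities → EReal // ∃ Z : Linfty P, ρ Z ≤ 0 ∧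
    α = fun g => ((∫ t : Ioo (0 : ℝ) 1, VaR P Z t * g.1 t ∂lebesgue : ℝ) : EReal)},
    fun l => l.down.1, ?_, fun X => ⟨?_, ?_⟩⟩
  · rintro ⟨α, Z, hZ, rfl⟩
    exact isConvexFunctional_density Z
  · refine ⟨⟨⟨_, _, (hm.map_add_self X).le, rfl⟩⟩, ?_⟩
    have (g : decreasingDensities) :
        ((∫ t : Ioo (0 : ℝ) 1, VaR P X t * g.1 t ∂lebesgue : ℝ) : EReal)
          - ((∫ t : Ioo (0 : ℝ) 1, VaR P (X + Lp.const ⊤ P (ρ X)) t * g.1 t ∂lebesgue : ℝ) : EReal)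
          = ρ X := by
      have h := (isSpectral_density (P := P) g.2).add_const X (ρ X)
      beta_reduce at h
      rw [h, ← EReal.coe_sub, sub_sub_cancel]
    simp only [this, iSup_const]
  · rintro _ ⟨⟨α, Z, hZ, rfl⟩, rfl⟩
    -- A real r strictly between the supremum and ρ(X) bounds every difference AVaR(X) - AVaR(Z),
    -- forcing ρ(X) ≤ r.
    by_contra! hlt
    obtain ⟨r, hr, hrX⟩ := EReal.lt_iff_exists_real_btwn.1 hlt
    refine absurd (le_of_AVaR_le hm hs hZ fun s h0 => ?_)
      (not_le.2 (EReal.coe_lt_coe_iff.1 hrX))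
    obtain ⟨g, hg, hgA⟩ := exists_density_eq_AVaR P h0
    have h := (le_iSup (fun g : decreasingDensities =>
      ((∫ t : Ioo (0 : ℝ) 1, VaR P X t * g.1 t ∂lebesgue : ℝ) : EReal)
        - ((∫ t : Ioo (0 : ℝ) 1, VaR P Z t * g.1 t ∂lebesgue : ℝ) : EReal)) ⟨g, hg⟩).trans hr.le
    beta_reduce at h
    rw [hgA, hgA, ← EReal.coe_sub, EReal.coe_le_coe_iff] at h
    linarith

/-! ### Representation by concave distribution functions -/

lemma continuous_integral_VaR (X : Linfty P) :
    Continuous fun ψ : ConcaveDistFun => ∫ t : I, VaR P X t ∂ψ.measure := by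
  refine continuous_coinduced_dom.2 ?_
  simp only [Function.comp_def, integral_VaR_J]
  exact DistFun.continuous_integral (continuous_AVaR X)

lemma DistFun.measure_eq_of_toFun_eq {x y z : DistFun} {a b : ℝ} (ha : 0 ≤ a) (hb : 0 ≤ b)
    (h : (z.toFun : I → ℝ) = a • x.toFun + b • y.toFun) :
    z.measure = ENNReal.ofReal a • x.measure + ENNReal.ofReal b • y.measure := by
  have hnn (w : DistFun) (t : I) : 0 ≤ w.toFun t := w.zero_nonneg.trans (w.mono' t.2.1)
  refine Measure.ext_of_Iic _ _ fun t => ?_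
  rw [Measure.add_apply, Measure.smul_apply, Measure.smul_apply, measure_Iic, measure_Iic,
    measure_Iic, congrFun h t, smul_eq_mul, smul_eq_mul, ← ENNReal.ofReal_mul ha,
    ← ENNReal.ofReal_mul hb, ← ENNReal.ofReal_add (mul_nonneg ha (hnn x t))
      (mul_nonneg hb (hnn y t))]
  rfl

lemma isConvexFunctional_concave (Z : Linfty P) :
    IsConvexFunctional (fun ψ : ConcaveDistFun => ψ.toFun)
      fun ψ => ((∫ t : I, VaR P Z t ∂ψ.measure : ℝ) : EReal) := by
  refine ⟨fun ψ => EReal.coe_ne_bot _, fun x y z a b ha hb hab hz => ?_⟩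
  beta_reduce
  rw [DistFun.measure_eq_of_toFun_eq ha hb hz,
    integral_add_measure ((integrable_VaR Z _).smul_measure ENNReal.ofReal_ne_top)
      ((integrable_VaR Z _).smul_measure ENNReal.ofReal_ne_top),
    integral_smul_measure, integral_smul_measure, ENNReal.toReal_ofReal ha,
    ENNReal.toReal_ofReal hb]
  exact le_of_eq (by simp)

/-- If s maximizes AVaR(X) - AVaR(Z) on [0, 1], then J(δ_s) maximizes over Ψ: by `IsSpectral.le_add`
no spectral functional separates X and Z by more than the largest AVaR difference. -/
lemma exists_isMinMax_concave (hm : IsMonetary P ρ) (hs : IsSSDConsistent P ρ) :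
    ∃ (Λ : Type v) (α : Λ → ConcaveDistFun → EReal),
      (∀ l, LowerSemicontinuous (α l) ∧
        IsConvexFunctional (fun ψ : ConcaveDistFun => ψ.toFun) (α l)) ∧
      ∀ X : Linfty P, IsMinMax (fun _ => univ)
        (fun l ψ => ((∫ t : I, VaR P X t ∂ψ.measure : ℝ) : EReal) - α l ψ) (ρ X) := by
  refine ⟨ULift.{v} {α : ConcaveDistFun → EReal // ∃ Z : Linfty P, ρ Z ≤ 0 ∧
    α = fun ψ => ((∫ t : I, VaR P Z t ∂ψ.measure : ℝ) : EReal)},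
    fun l => l.down.1, ?_, fun X => isMinMax_of ?_ ?_⟩
  · rintro ⟨α, Z, hZ, rfl⟩
    exact ⟨(continuous_coe_real_ereal.comp (continuous_integral_VaR Z)).lowerSemicontinuous,
      isConvexFunctional_concave Z⟩
  · rintro ⟨α, Z, hZ, rfl⟩
    obtain ⟨s, -, hmax⟩ := isCompact_univ.exists_isMaxOn (univ_nonempty (α := I))
      ((continuous_AVaR X).sub (continuous_AVaR Z)).continuousOn
    have hle (r : I) : AVaR P X r ≤ AVaR P Z r + (AVaR P X s - AVaR P Z s) := by
      have := hmax (mem_univ r)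
      simp only [mem_ofPred_eq, Pi.sub_apply] at this
      linarith
    refine ⟨J (DistFun.ofMeasure (Measure.dirac s)), mem_univ _, fun ψ _ => ?_, ?_⟩
    · dsimp only
      rw [← AVaR_eq_integral_J_dirac, ← AVaR_eq_integral_J_dirac, ← EReal.coe_sub,
        ← EReal.coe_sub, EReal.coe_le_coe_iff]
      have := ψ.isSpectral.le_add fun r _ => hle r
      beta_reduce at this
      linarith
    · dsimp only
      rw [← AVaR_eq_integral_J_dirac, ← AVaR_eq_integral_J_dirac, ← EReal.coe_sub,
        EReal.coe_le_coe_iff]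
      exact le_of_AVaR_le hm hs hZ fun r _ => hle r
  · refine ⟨⟨⟨_, _, (hm.map_add_self X).le, rfl⟩⟩, fun ψ _ => ?_⟩
    have h := (ψ.isSpectral (P := P)).add_const X (ρ X)
    dsimp only at h ⊢
    rw [h, ← EReal.coe_sub, sub_sub_cancel]

/-! ### Positively homogeneous risk measures -/

/-- The pairs (∫u dμ, ∫v dμ) form a compact convex set in the plane that misses the quadrant x ≥ 0,
y ≤ 0. A separating functional px + qy has p > 0 ≥ q, and evaluating it at Dirac measures gives a =
-q/p. -/
lemma exists_le_mul_of_integral_neg {u v : I → ℝ} (hu : Continuous u) (hv : Continuous v)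
    (h : ∀ μ : ProbabilityMeasure I, ∫ s, v s ∂μ ≤ 0 → ∫ s, u s ∂μ < 0) (hne : ∃ s, v s ≤ 0) :
    ∃ a : ℝ, 0 ≤ a ∧ ∀ s, u s ≤ a * v s := by
  let T : ProbabilityMeasure I → ℝ × ℝ := fun μ => (∫ s, u s ∂μ, ∫ s, v s ∂μ)
  have hT : Continuous T :=
    (ProbabilityMeasure.continuous_integral_boundedContinuousFunction
      (BoundedContinuousFunction.mkOfCompact ⟨u, hu⟩)).prodMk
    (ProbabilityMeasure.continuous_integral_boundedContinuousFunction
      (BoundedContinuousFunction.mkOfCompact ⟨v, hv⟩))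
  have hint {f : I → ℝ} (hf : Continuous f) (μ : Measure I) [IsFiniteMeasure μ] :
      Integrable f μ := by
    have := hf.continuousOn.integrableOn_compact (μ := μ) (isCompact_univ (X := I))
    rwa [integrableOn_univ] at this
  have hconv : Convex ℝ (range T) := by
    rintro _ ⟨μ, rfl⟩ _ ⟨ν, rfl⟩ a b ha hb hab
    let κ : Measure I := ENNReal.ofReal a • (μ : Measure I) + ENNReal.ofReal b • (ν : Measure I)
    have hκ : IsProbabilityMeasure κ := ⟨by
      simp [κ, ← ENNReal.ofReal_add ha hb, hab]⟩
    have hf {f : I → ℝ} (hf : Continuous f) :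
        ∫ s, f s ∂κ = a * ∫ s, f s ∂μ + b * ∫ s, f s ∂ν := by
      rw [integral_add_measure ((hint hf _).smul_measure ENNReal.ofReal_ne_top)
        ((hint hf _).smul_measure ENNReal.ofReal_ne_top), integral_smul_measure,
        integral_smul_measure, ENNReal.toReal_ofReal ha, ENNReal.toReal_ofReal hb]
      rfl
    exact ⟨⟨κ, hκ⟩, Prod.ext (hf hu) (hf hv)⟩
  have hC : Convex ℝ (Ici (0 : ℝ) ×ˢ Iic (0 : ℝ)) := (convex_Ici 0).prod (convex_Iic 0)
  have hdisj : Disjoint (range T) (Ici (0 : ℝ) ×ˢ Iic (0 : ℝ)) := by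
    rw [disjoint_left]
    rintro _ ⟨μ, rfl⟩ hμ
    exact absurd (h μ hμ.2) (not_lt.2 hμ.1)
  obtain ⟨f, α, β, hα, hαβ, hβ⟩ := geometric_hahn_banach_compact_closed hconv
    (isCompact_range hT) hC (isClosed_Ici.prod isClosed_Iic) hdisj
  set p := f (1, 0)
  set q := f (0, 1)
  have hf (x y : ℝ) : f (x, y) = x * p + y * q := by
    have : ((x, y) : ℝ × ℝ) = x • (1, 0) + y • (0, 1) := by simp
    rw [this, map_add, map_smul, map_smul, smul_eq_mul, smul_eq_mul]
  have hβ' (x y : ℝ) (hx : 0 ≤ x) (hy : y ≤ 0) : β < x * p + y * q := by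
    rw [← hf]
    exact hβ _ ⟨hx, hy⟩
  have hβ0 : β < 0 := by simpa using hβ' 0 0 le_rfl le_rfl
  have hp0 : 0 ≤ p := by
    by_contra! hneg
    -- The point of the quadrant at which the functional would equal β exactly.
    have := hβ' (β / p) 0 (div_nonneg_of_nonpos hβ0.le hneg.le) le_rfl
    rw [div_mul_cancel₀ _ hneg.ne, zero_mul, add_zero] at this
    exact lt_irrefl _ this
  have hq0 : q ≤ 0 := by
    by_contra! hpos
    have := hβ' 0 (β / q) le_rfl (div_nonpos_of_nonpos_of_nonneg hβ0.le hpos.le)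
    rw [div_mul_cancel₀ _ hpos.ne', zero_mul, zero_add] at this
    exact lt_irrefl _ this
  have hpt (s : I) : u s * p + v s * q < 0 := by
    have := hα (T ⟨Measure.dirac s, inferInstance⟩) (mem_range_self _)
    simp only [T, ProbabilityMeasure.coe_mk, integral_dirac, hf] at this
    linarith
  -- A Slater condition: a point with v ≤ 0 excludes the degenerate separation p = 0.
  have hp1 : 0 < p := by
    refine hp0.lt_of_ne fun h0 => ?_
    obtain ⟨s, hs⟩ := hne
    have := hpt s
    rw [← h0, mul_zero, zero_add] at this
    exact absurd this (not_lt.2 (mul_nonneg_of_nonpos_of_nonpos hs hq0))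
  refine ⟨-q / p, div_nonneg (neg_nonneg.2 hq0) hp0, fun s => ?_⟩
  rw [div_mul_eq_mul_div, le_div_iff₀ hp1]
  linarith [hpt s]

/-- The concave distribution functions under which `Z` is acceptable. -/
def acceptingSet (P : Measure Ω) (Z : Linfty P) : Set ConcaveDistFun :=
  J '' {w | ∫ s, AVaR P Z s ∂w.measure ≤ 0}

lemma isCompact_acceptingSet (Z : Linfty P) : IsCompact (acceptingSet P Z) :=
  (isClosed_le (DistFun.continuous_integral (continuous_AVaR Z))
    continuous_const).isCompact.image continuous_J

lemma integral_VaR_nonpos_of_mem_acceptingSet {Z : Linfty P} {ψ : ConcaveDistFun}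
    (hψ : ψ ∈ acceptingSet P Z) : ∫ t : I, VaR P Z t ∂ψ.measure ≤ 0 := by
  obtain ⟨w, hw, rfl⟩ := hψ
  rw [integral_VaR_J]
  exact hw

lemma integrable_AVaR (X : Linfty P) (μ : Measure I) [IsFiniteMeasure μ] :
    Integrable (AVaR P X) μ := by
  have := (continuous_AVaR X).continuousOn.integrableOn_compact (μ := μ) (isCompact_univ (X := I))
  rwa [integrableOn_univ] at this

lemma convex_acceptingSet (Z : Linfty P) :
    Convex ℝ ((fun ψ : ConcaveDistFun => (ψ.toFun : I → ℝ)) '' acceptingSet P Z) := by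
  rintro _ ⟨_, ⟨w₁, hw₁, rfl⟩, rfl⟩ _ ⟨_, ⟨w₂, hw₂, rfl⟩, rfl⟩ a b ha hb hab
  let κ : Measure I := ENNReal.ofReal a • w₁.measure + ENNReal.ofReal b • w₂.measure
  have hκ : IsProbabilityMeasure κ := ⟨by simp [κ, ← ENNReal.ofReal_add ha hb, hab]⟩
  have hm : (DistFun.ofMeasure κ).measure
      = ENNReal.ofReal a • w₁.measure + ENNReal.ofReal b • w₂.measure :=
    DistFun.measure_ofMeasure κ
  refine ⟨J (DistFun.ofMeasure κ), ⟨_, ?_, rfl⟩, mixFun_convexCombination ha hb hm⟩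
  rw [mem_ofPred_eq, hm,
    integral_add_measure ((integrable_AVaR Z _).smul_measure ENNReal.ofReal_ne_top)
      ((integrable_AVaR Z _).smul_measure ENNReal.ofReal_ne_top),
    integral_smul_measure, integral_smul_measure, ENNReal.toReal_ofReal ha,
    ENNReal.toReal_ofReal hb]
  exact add_nonpos (mul_nonpos_of_nonneg_of_nonpos ha hw₁)
    (mul_nonpos_of_nonneg_of_nonpos hb hw₂)

/-- Otherwise AVaR(Z) has a minimum m > 0 on [0, 1] by compactness; comparing 0 with Z then gives
ρ(0) ≤ -m, against ρ(0) = 0. -/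
lemma exists_AVaR_nonpos (hm : IsMonetary P ρ) (hs : IsSSDConsistent P ρ)
    (hh : IsPosHomogeneous P ρ) {Z : Linfty P} (hZ : ρ Z ≤ 0) : ∃ s, AVaR P Z s ≤ 0 := by
  by_contra! hpos
  obtain ⟨s, -, hmin⟩ := isCompact_univ.exists_isMinOn (univ_nonempty (α := I))
    (continuous_AVaR Z).continuousOn
  have h0 (r : I) : AVaR P (0 : Linfty P) r = 0 := by
    have := (isSpectral_AVaR (P := P) r).smul 0 le_rfl
    simpa using this
  have h := le_of_AVaR_le hm hs (X := 0) (r := -AVaR P Z s) hZ fun r _ => by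
    have := hmin (mem_univ r)
    simp only [mem_ofPred_eq] at this
    rw [h0]
    linarith
  have hρ0 : ρ 0 = 0 := by
    have := hh 0 0 le_rfl
    rwa [zero_smul, zero_mul] at this
  linarith [hpos s]

lemma acceptingSet_nonempty (hm : IsMonetary P ρ) (hs : IsSSDConsistent P ρ)
    (hh : IsPosHomogeneous P ρ) {Z : Linfty P} (hZ : ρ Z ≤ 0) : (acceptingSet P Z).Nonempty := by
  obtain ⟨s, h⟩ := exists_AVaR_nonpos hm hs hh hZ
  refine ⟨_, DistFun.ofMeasure (Measure.dirac s), ?_, rfl⟩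
  rwa [mem_ofPred_eq, DistFun.measure_ofMeasure, integral_dirac]

lemma le_of_integral_VaR_lt (hm : IsMonetary P ρ) (hs : IsSSDConsistent P ρ)
    (hh : IsPosHomogeneous P ρ) {X Z : Linfty P} {r : ℝ} (hZ : ρ Z ≤ 0)
    (h : ∀ ψ ∈ acceptingSet P Z, ∫ t : I, VaR P X t ∂ψ.measure < r) : ρ X ≤ r := by
  obtain ⟨a, ha, hle⟩ := exists_le_mul_of_integral_neg
    ((continuous_AVaR X).sub (continuous_const (y := r))) (continuous_AVaR Z) (fun μ hμ => by
      have hw := h _ ⟨DistFun.ofMeasure (μ : Measure I), by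
        rwa [mem_ofPred_eq, DistFun.measure_ofMeasure], rfl⟩
      rw [integral_VaR_J, DistFun.measure_ofMeasure] at hw
      simp only [Pi.sub_apply]
      rw [integral_sub (integrable_AVaR X _) (integrable_const r)]
      simpa using hw) (exists_AVaR_nonpos hm hs hh hZ)
  refine le_of_AVaR_le hm hs (Z := a • Z) ?_ fun s _ => ?_
  · rw [hh Z a ha]
    exact mul_nonpos_of_nonneg_of_nonpos ha hZ
  · have h1 := (isSpectral_AVaR (P := P) s).smul Z ha
    have h2 := hle s
    rw [Pi.sub_apply] at h2
    linarith

lemma exists_isMinMax_acceptingSet (hm : IsMonetary P ρ) (hs : IsSSDConsistent P ρ)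
    (hh : IsPosHomogeneous P ρ) :
    ∃ (Λ : Type v) (K : Λ → Set ConcaveDistFun),
      (∀ l, (K l).Nonempty ∧ IsCompact (K l) ∧
        Convex ℝ ((fun ψ : ConcaveDistFun => (ψ.toFun : I → ℝ)) '' K l)) ∧
      ∀ X : Linfty P, IsMinMax K
        (fun _ ψ => ((∫ t : I, VaR P X t ∂ψ.measure : ℝ) : EReal)) (ρ X) := by
  refine ⟨ULift.{v} {K : Set ConcaveDistFun // ∃ Z : Linfty P, ρ Z ≤ 0 ∧ K = acceptingSet P Z},
    fun l => l.down.1, ?_, fun X => isMinMax_of ?_ ?_⟩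
  · rintro ⟨K, Z, hZ, rfl⟩
    exact ⟨acceptingSet_nonempty hm hs hh hZ, isCompact_acceptingSet Z, convex_acceptingSet Z⟩
  · rintro ⟨K, Z, hZ, rfl⟩
    obtain ⟨ψ, hψ, hmax⟩ := (isCompact_acceptingSet Z).exists_isMaxOn
      (acceptingSet_nonempty hm hs hh hZ) (continuous_integral_VaR X).continuousOn
    refine ⟨ψ, hψ, fun φ hφ => EReal.coe_le_coe_iff.2 (hmax hφ), EReal.coe_le_coe_iff.2 ?_⟩
    -- The separation needs a strict bound, so r runs over all numbers above the maximum.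
    exact le_of_forall_gt_imp_ge_of_dense fun r hr =>
      le_of_integral_VaR_lt hm hs hh hZ fun φ hφ => lt_of_le_of_lt (hmax hφ) hr
  · refine ⟨⟨⟨_, _, (hm.map_add_self X).le, rfl⟩⟩, fun ψ hψ => EReal.coe_le_coe_iff.2 ?_⟩
    have h1 := integral_VaR_nonpos_of_mem_acceptingSet hψ
    have h2 := (ψ.isSpectral (P := P)).add_const X (ρ X)
    beta_reduce at h2
    linarith

lemma isPosHomogeneous_of_isMinMax {Λ S : Type*} {K : Λ → Set S} {Φ : S → Linfty P → ℝ}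
    (hΦ : ∀ s, IsSpectral P (Φ s))
    (h : ∀ X, IsMinMax K (fun _ s => ((Φ s X : ℝ) : EReal)) (ρ X)) : IsPosHomogeneous P ρ := by
  have hle (X : Linfty P) {a : ℝ} (ha : 0 ≤ a) : ρ (a • X) ≤ a * ρ X := by
    obtain ⟨l, hl⟩ := (h X).le_and_exists.2
    refine EReal.coe_le_coe_iff.1 ((h (a • X)).le_and_exists.1 l _ fun s hs => ?_)
    rw [EReal.coe_le_coe_iff, (hΦ s).smul X ha]
    exact mul_le_mul_of_nonneg_left (EReal.coe_le_coe_iff.1 (hl s hs)) ha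
  intro X a ha
  refine le_antisymm (hle X ha) ?_
  rcases ha.eq_or_lt with rfl | ha
  -- Zero has no inverse; here ρ(0) = ρ(2·0) ≤ 2ρ(0) gives ρ(0) ≥ 0.
  · have := hle (0 : Linfty P) zero_le_two
    rw [smul_zero] at this
    rw [zero_smul, zero_mul]
    linarith
  · have := hle (a • X) (inv_nonneg.2 ha.le)
    rwa [inv_smul_smul₀ ha.ne', ← div_eq_inv_mul, le_div_iff₀ ha, mul_comm] at this

end Representation

end RiskMeasures

end

theorem mainTheorem8 {Ω : Type u} [MeasurableSpace Ω] (P : Measure Ω)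
    [IsProbabilityMeasure P] (hP : IsNonatomic P) (ρ : Linfty P → ℝ) :
    ((IsMonetary P ρ ∧ IsSSDConsistent P ρ) ↔
      ∃ (Λ : Type v) (α : Λ → decreasingDensities → EReal),
        (∀ l, IsConvexFunctional (fun g : decreasingDensities => g.1) (α l)) ∧
        ∀ X : Linfty P, IsMinSup
          (fun l g => ((∫ t : Ioo (0 : ℝ) 1, VaR P X t * g.1 t ∂lebesgue : ℝ) : EReal) - α l g) (ρ X)) ∧
    ((IsMonetary P ρ ∧ IsSSDConsistent P ρ) ↔
      ∃ (Λ : Type v) (α : Λ → ConcaveDistFun → EReal),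
        (∀ l, LowerSemicontinuous (α l) ∧
          IsConvexFunctional (fun ψ : ConcaveDistFun => ψ.toFun) (α l)) ∧
        ∀ X : Linfty P, IsMinMax (fun _ => univ)
          (fun l ψ => ((∫ t : I, VaR P X t ∂ψ.measure : ℝ) : EReal) - α l ψ) (ρ X)) ∧
    ((IsMonetary P ρ ∧ IsSSDConsistent P ρ ∧ IsPosHomogeneous P ρ) ↔
      ∃ (Λ : Type v) (K : Λ → Set ConcaveDistFun),
        (∀ l, (K l).Nonempty ∧ IsCompact (K l) ∧
          Convex ℝ ((fun ψ : ConcaveDistFun => ψ.toFun) '' K l)) ∧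
        ∀ X : Linfty P, IsMinMax K
          (fun _ ψ => ((∫ t : I, VaR P X t ∂ψ.measure : ℝ) : EReal)) (ρ X)) := by
  refine ⟨⟨fun h => exists_isMinSup_density h.1 h.2, ?_⟩,
    ⟨fun h => exists_isMinMax_concave h.1 h.2, ?_⟩,
    ⟨fun h => exists_isMinMax_acceptingSet h.1 h.2.1 h.2.2, ?_⟩⟩
  · rintro ⟨Λ, α, -, h⟩
    exact isMonetary_and_isSSDConsistent_of_spectral
      (fun g : decreasingDensities => isSpectral_density g.2)
      fun X Y c => le_add_of_le_and_exists fun X => (h X).le_and_exists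
  · rintro ⟨Λ, α, -, h⟩
    exact isMonetary_and_isSSDConsistent_of_spectral ConcaveDistFun.isSpectral
      fun X Y c => le_add_of_le_and_exists fun X => (h X).le_and_exists
  · rintro ⟨Λ, K, -, h⟩
    have h' := isMonetary_and_isSSDConsistent_of_spectral (ρ := ρ) ConcaveDistFun.isSpectral
      fun X Y c => le_add_of_le_and_exists (K := K) (α := fun _ _ => 0) fun X => by
        simpa only [sub_zero] using (h X).le_and_exists
    exact ⟨h'.1, h'.2, isPosHomogeneous_of_isMinMax ConcaveDistFun.isSpectral h⟩
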